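/- **Setting.** Let $M\in\mathbb{R}^{d\times d}$ ($d\ge 1$) be symmetric positive semi-definite with largest eigenvalue $\lambda_1\in(0,1]$. Actions are the $a\in\mathbb{R}^d$ with $\|a\|_2\le 1$, the mean reward is $f(a)=a^\top M a$, and $f^*=\sup_{\|a\|_2\le1}f(a)$. In round $t$ the player plays $a_t$ and observes $f(a_t)+\eta_t$, where $\eta_t$ is zero-mean and 1-sub-Gaussian conditionally on everything drawn or observed before this reward, including $a_t$ and all perturbations drawn so far (for example $\eta_t\sim\mathcal N(0,1)$ independent of the past). **Noisy power method** (accuracy $\epsilon_0\in(0,1/2)$, parameter $\alpha=1-\epsilon_0^2/2$ in place of the eigenvalue ratio, constants $q\in\mathbb N$, $C_L,C_m,C_n>0$). Put $$L=\Big\lfloor \frac{C_L\log(d/\epsilon_0)}{1-\alpha}\Big\rfloor+1,\qquad \delta=\frac{0.1}{L},\qquad g=\lambda_1(1-\alpha),$$ $$n=\Big\lceil C_n\,\frac{d^2}{g^{2}\epsilon_0^{2}}\,\log^q\!\Big(\frac{d}{\delta\, g\,\epsilon_0}\Big)\Big\rceil,\qquad m=C_m\,d\log(n/\delta).$$ Draw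 $a_0$ uniformly on the unit sphere. For $l=1,\dots,L$: draw, independently of everything before, $z_1,\dots,z_n$ i.i.d. from $\mathcal N(0,\frac1m I_d)$, re-sampling the whole batch until all $\|z_i\|_2\le 1$; play the $n$ actions $\frac12(a_{l-1}+z_i)$ and observe the noisy rewards $r_i$; set $y=\frac mn\sum_{i=1}^n r_i z_i$ and $a_l=y/\|y\|_2$. Output $a_L$. The number of samples used is $Ln$. **Claim.** There are universal $q,p\in\mathbb N$ such that for every large enough universal $C_L$, then every large enough $C_m$ (depending on $C_L$), then every large enough $C_n$ (depending on $C_L,C_m$), there is a constant $C>0$, depending only on these constants, such that for all $d$, $M$ and noises as above: 1. For every $0<\varepsilon<\lambda_1/4$, the method run with $\epsilon_0=\sqrt{\varepsilon/\lambda_1}$ and $\alpha=1-\epsilon_0^2/2$ uses $$Ln\le C\,\frac{d^2\lambda_1^2}{\varepsilon^4}\,\log^p(d/\varepsilon)$$ samples, and with probability at least $0.9$ its output satisfies $f^*-f(a_L)\le\varepsilon$. 2. For every horizon $T\ge1$, run the method with $\epsilon_0=\min\{\frac14,(d^2/(\lambda_1^2T))^{1/10}\}$ and $\alpha=1-\epsilon_0^2/2$,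 and play its output $a_L$ in all rounds after the first $Ln$ (explore-then-commit). Almost surely all actions played have norm at most $1$, and with probability at least $0.9$ the cumulative regret of the first $T$ rounds satisfies $$\sum_{t=1}^T\big(f^*-f(a_t)\big)\le C\,\lambda_1^{3/5}d^{2/5}T^{4/5}\,\big(1+\log(dT)\big)^p .$$ -/

import Mathlib

open MeasureTheory ProbabilityTheory
open scoped Matrix

/-- The ambient space `ℝ^d` with the Euclidean norm. -/
abbrev Vec (d : ℕ) : Type := EuclideanSpace ℝ (Fin d)

/-- The mean reward `f(a) = aᵀ M a`. -/
def quadReward {d : ℕ} (M : Matrix (Fin d) (Fin d) ℝ) (a : Vec d) : ℝ :=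
  a.ofLp ⬝ᵥ (M *ᵥ a.ofLp)

/-- The optimal mean reward `f* = sup_{‖a‖ ≤ 1} f(a)`. -/
noncomputable def bestReward {d : ℕ} (M : Matrix (Fin d) (Fin d) ℝ) : ℝ :=
  ⨆ a : Metric.closedBall (0 : Vec d) 1, quadReward M a

/-- The cumulative regret `∑_t (f* - f(a_t))` of the first `T` actions. -/
noncomputable def cumRegret {d : ℕ} (M : Matrix (Fin d) (Fin d) ℝ) (a : ℕ → Vec d) (T : ℕ) : ℝ :=
  ∑ t ∈ Finset.range T, (bestReward M - quadReward M (a t))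

/-- Numerical inputs of the noisy power method: number of iterations `L`, number of samples per
iteration `n`, and precision `m` of the exploration noise `z ∼ N(0, I / m)`. -/
structure NPMParams where
  iters : ℕ
  batch : ℕ
  prec : ℝ

/-- The total number of samples `L n`. -/
def NPMParams.samples (P : NPMParams) : ℕ := P.iters * P.batch

/-- Number of iterations: `L = ⌊C_L log(d/ε) / (1 - α)⌋ + 1`. -/
noncomputable def npmIters (CL : ℝ) (d : ℕ) (α ε : ℝ) : ℕ :=
  ⌊CL * Real.log (d / ε) / (1 - α)⌋₊ + 1

/-- Samples per iteration, for the presumed gap `g = lam (1 - α)` and failure probability `δ`: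
`n = ⌈C_n d² log(d / (δ g ε))^q g⁻² ε⁻²⌉`. -/
noncomputable def npmBatch (Cn : ℝ) (q d : ℕ) (lam α ε δ : ℝ) : ℕ :=
  ⌈Cn * (d : ℝ) ^ 2 * Real.log (d / (δ * (lam * (1 - α)) * ε)) ^ q
    / ((lam * (1 - α)) ^ 2 * ε ^ 2)⌉₊

/-- The inputs used in dimension `d`, for top eigenvalue `lam`, presumed eigenvalue ratio `α` and
accuracy `ε`; the failure probability per iteration is `δ = 0.1 / L` and `m = C_m d log(n/δ)`. -/
noncomputable def npmParams (CL Cm Cn : ℝ) (q d : ℕ) (lam α ε : ℝ) : NPMParams :=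
  let L := npmIters CL d α ε
  let δ : ℝ := 1 / (10 * L)
  let n := npmBatch Cn q d lam α ε δ
  { iters := L
    batch := n
    prec := Cm * d * Real.log (n / δ) }

/-- The exploratory action `(a + z) / 2`. -/
noncomputable def exploreAction {d : ℕ} (a z : Vec d) : Vec d := (1 / 2 : ℝ) • (a + z)

/-- The next iterate, from the perturbations `z i` and the observed rewards `r i`:
`y / ‖y‖` with `y = (m/n) ∑ i, r_i z_i`. -/
noncomputable def npmUpdate {d n : ℕ} (m : ℝ) (z : Fin n → Vec d) (r : Fin n → ℝ) : Vec d :=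
  let y : Vec d := (m / n) • ∑ i, r i • z i
  ‖y‖⁻¹ • y

/-- The iterates `a_0, a_1, …` of the noisy power method. In iteration `l` (counted from `0`) the
perturbations are `z l`; its `i`-th sample is taken in round `l n + i`, where the observed reward
is the mean reward of the action played plus the noise `η (l n + i)`. -/
noncomputable def npmIterate {d : ℕ} (M : Matrix (Fin d) (Fin d) ℝ) (P : NPMParams)
    (a₀ : Vec d) (z : ℕ → Fin P.batch → Vec d) (η : ℕ → ℝ) : ℕ → Vec d
  | 0 => a₀
  | l + 1 =>
      let a := npmIterate M P a₀ z η l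
      npmUpdate P.prec (z l)
        (fun i => quadReward M (exploreAction a (z l i)) + η (l * P.batch + i))

/-- The output `a_L` of the noisy power method. -/
noncomputable def npmOutput {d : ℕ} (M : Matrix (Fin d) (Fin d) ℝ) (P : NPMParams)
    (a₀ : Vec d) (z : ℕ → Fin P.batch → Vec d) (η : ℕ → ℝ) : Vec d :=
  npmIterate M P a₀ z η P.iters

/-- Explore-then-commit: in the first `L n` rounds play the actions of the noisy power method,
in all later rounds its output. -/
noncomputable def etcAction {d : ℕ} (M : Matrix (Fin d) (Fin d) ℝ) (P : NPMParams)
    (a₀ : Vec d) (z : ℕ → Fin P.batch → Vec d) (η : ℕ → ℝ) (t : ℕ) : Vec d :=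
  if h : t < P.samples then
    exploreAction (npmIterate M P a₀ z η (t / P.batch))
      (z (t / P.batch) ⟨t % P.batch, Nat.mod_lt _ (Nat.pos_of_ne_zero (fun h0 => by
        simp [NPMParams.samples, h0] at h))⟩)
  else npmOutput M P a₀ z η

/-- The uniform distribution on the unit sphere of `ℝ^d`. -/
noncomputable def uniformSphere (d : ℕ) : Measure (Vec d) :=
  (((volume : Measure (Vec d)).toSphere Set.univ)⁻¹ • (volume : Measure (Vec d)).toSphere).map
    Subtype.val

/-- The Gaussian distribution `N(0, I_d / m)`. -/
noncomputable def gaussianVec (d : ℕ) (m : ℝ) : Measure (Vec d) :=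
  (stdGaussian (Vec d)).map (fun x => (Real.sqrt m)⁻¹ • x)

/-- The law of a batch of `n` i.i.d. samples of `N(0, I_d / m)` that is re-sampled as a whole until
all of its members have norm at most `1`. -/
noncomputable def batchLaw (d n : ℕ) (m : ℝ) : Measure (Fin n → Vec d) :=
  ProbabilityTheory.cond (Measure.pi (fun _ : Fin n => gaussianVec d m)) {z | ∀ i, ‖z i‖ ≤ 1}

/-- The information carried by the initial action, the first `k` batches of perturbations and
the noise of the first `t` rounds. -/
abbrev history {Ω : Type*} {d n : ℕ} (A₀ : Ω → Vec d) (Z : ℕ → Ω → Fin n → Vec d)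
    (η : ℕ → Ω → ℝ) (k t : ℕ) : MeasurableSpace Ω :=
  MeasurableSpace.comap A₀ inferInstance
    ⊔ (⨆ j : Fin k, MeasurableSpace.comap (Z j) inferInstance)
    ⊔ (⨆ s : Fin t, MeasurableSpace.comap (η s) inferInstance)

/-- The randomness of a run of the noisy power method with inputs `P`: the initial action is
uniform on the sphere, each batch of perturbations is drawn with the prescribed law independently
of everything before that batch, and the reward noise in each round is conditionally zero-mean and
1-sub-Gaussian given all the randomness before the reward is observed (which includes the current
batch, hence the action played). -/
structure IsNPMRun {Ω : Type*} [MeasurableSpace Ω] (μ : Measure Ω) {d : ℕ} (P : NPMParams)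
    (A₀ : Ω → Vec d) (Z : ℕ → Ω → Fin P.batch → Vec d) (η : ℕ → Ω → ℝ) : Prop where
  measurable_init : Measurable A₀
  measurable_batch : ∀ l, Measurable (Z l)
  measurable_noise : ∀ t, Measurable (η t)
  init_law : μ.map A₀ = uniformSphere d
  batch_law : ∀ l < P.iters, μ.map (Z l) = batchLaw d P.batch P.prec
  batch_indep : ∀ l < P.iters,
    Indep (MeasurableSpace.comap (Z l) inferInstance) (history A₀ Z η l (l * P.batch)) μ
  noise_integrable : ∀ t < P.samples, Integrable (η t) μ
  noise_mean : ∀ t < P.samples,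
    μ[η t | history A₀ Z η (t / P.batch + 1) t] =ᵐ[μ] 0
  noise_exp_integrable : ∀ t < P.samples, ∀ s : ℝ, Integrable (fun ω => Real.exp (s * η t ω)) μ
  noise_subGaussian : ∀ t < P.samples, ∀ s : ℝ,
    μ[fun ω => Real.exp (s * η t ω) | history A₀ Z η (t / P.batch + 1) t]
      ≤ᵐ[μ] fun _ => Real.exp (s ^ 2 / 2)

/-! Put `A = M / λ₁`, so that `0 ≤ A ≤ 1` and `A v = v` for a unit top eigenvector `v`. The only
part of `f((a + z)/2)` that is odd in `z` is `⟪M a, z⟫ / 2`. Correlating the rewards with a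
rotation-invariant `z` therefore gives a vector whose mean is a multiple of `M a`, and the method is
the power iteration `a ↦ (A a + g) / ‖A a + g‖` with random errors `g`.

No spectral gap is assumed, so the iterates need not approach `v`; what is controlled is the defect
`1 - ⟪a, A a⟫` (`perturbed_power_method`). Let `β l` be the product of the first `l` normalising
factors. Since `A` preserves the overlap with `v`, the vector `β l • a l` keeps a quarter of its
initial overlap as long as the errors along `v` are small in total; hence `β L` is not small. But a
step from a defect of at least `e² / 4` multiplies `β` by at most `exp (‖g‖ - e² / 8)`. So among `L
≈ log d / e²` iterates one has a smaller defect. Afterwards the defect stays below `e²`: an exact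
step does not increase it, and its square root comes from a seminorm, so that errors enter
additively (`LinearMap.IsPositive.sqrt_defect_step`).

The initial overlap is at least of order `1/√d` with probability `19/20`
(`uniformSphere_abs_inner_lt_le`). In a fixed direction the error of one iteration has second moment
`O(m/n)` (`IsNPMRun.lintegral_inner_runError_sq_le`): the reward part because the batch is
independent of the iterate, the noise part because it is a sum of martingale differences. Markov's
inequality for the totals over all iterations suffices (`IsNPMRun.prob_success`), provided `n` is a
large multiple of `L² m d / (λ₁² e²)`. Up to logarithms `L n` is then `d² / (λ₁² e⁸)`, and the
output is `λ₁ e²`-optimal. Taking `e² = ε / λ₁` gives the sample bound; balancing `λ₁ L n` against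
`T λ₁ e²` gives the regret bound. -/

/-! ### Positive operators and the deterministic power method with errors. -/

section PositiveForms

variable {E : Type*} [NormedAddCommGroup E] [InnerProductSpace ℝ E]

local notation "⟪" x ", " y "⟫" => inner ℝ x y

/-- Cauchy-Schwarz for the form of a positive operator. -/
theorem LinearMap.IsPositive.inner_sq_le {T : E →ₗ[ℝ] E} (hT : T.IsPositive) (x y : E) :
    ⟪x, T y⟫ ^ 2 ≤ ⟪x, T x⟫ * ⟪y, T y⟫ := by
  have hsym : ⟪y, T x⟫ = ⟪x, T y⟫ := by
    rw [← hT.isSymmetric y x, real_inner_comm]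
  have key : ∀ t : ℝ, 0 ≤ ⟪y, T y⟫ * (t * t) + 2 * ⟪x, T y⟫ * t + ⟪x, T x⟫ := by
    intro t
    have h := hT.inner_nonneg_right (x + t • y)
    simp only [map_add, map_smul, inner_add_left, inner_add_right, real_inner_smul_left,
      real_inner_smul_right, hsym] at h
    linarith
  have := discrim_le_zero key
  unfold discrim at this
  linarith

/-- This is the triangle inequality for the seminorm of a positive form. For the operator `1 - A`
the squared seminorm of a unit vector is its defect. -/
theorem LinearMap.IsPositive.sqrt_inner_add_le {T : E →ₗ[ℝ] E} (hT : T.IsPositive) (x y : E) :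
    √⟪x + y, T (x + y)⟫ ≤ √⟪x, T x⟫ + √⟪y, T y⟫ := by
  have hx := hT.inner_nonneg_right x
  have hy := hT.inner_nonneg_right y
  have hsym : ⟪y, T x⟫ = ⟪x, T y⟫ := by
    rw [← hT.isSymmetric y x, real_inner_comm]
  have hcs : ⟪x, T y⟫ ≤ √⟪x, T x⟫ * √⟪y, T y⟫ := by
    rw [← Real.sqrt_mul hx]
    exact Real.le_sqrt_of_sq_le (hT.inner_sq_le x y)
  apply Real.sqrt_le_iff.2 ⟨by positivity, ?_⟩
  rw [add_sq, Real.sq_sqrt hx, Real.sq_sqrt hy]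
  simp only [map_add, inner_add_left, inner_add_right, hsym]
  linarith

/-- A positive operator bounded by the identity satisfies `A² ≤ A`. -/
theorem LinearMap.IsPositive.norm_apply_sq_le {A : E →ₗ[ℝ] E} (hA : A.IsPositive)
    (hA1 : (LinearMap.id - A).IsPositive) (x : E) : ‖A x‖ ^ 2 ≤ ⟪x, A x⟫ := by
  -- This reads `‖A x‖⁴ ≤ ⟪A x, A (A x)⟫ ⟪x, A x⟫`, whose first factor is at most `‖A x‖²`; then `‖A
  -- x‖²` cancels.
  have h1 := hA.inner_sq_le (A x) x
  have h2 := hA1.inner_nonneg_right (A x)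
  simp only [LinearMap.sub_apply, LinearMap.id_apply, inner_sub_right,
    real_inner_self_eq_norm_sq] at h1 h2
  have h3 := hA.inner_nonneg_right x
  rcases (sq_nonneg ‖A x‖).eq_or_lt with h0 | h0
  · rw [← h0]; exact h3
  · nlinarith

/-- Applying a positive operator does not decrease the Rayleigh quotient. -/
theorem LinearMap.IsPositive.inner_mul_norm_sq_le {A : E →ₗ[ℝ] E} (hA : A.IsPositive) {x : E}
    (hx : ‖x‖ = 1) : ⟪x, A x⟫ * ‖A x‖ ^ 2 ≤ ⟪A x, A (A x)⟫ := by
  -- With `ρ = ⟪x, A x⟫ ≤ ‖A x‖` this gives `ρ² ‖A x‖² ≤ ‖A x‖⁴ ≤ ρ ⟪A x, A (A x)⟫`; then `ρ`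
  -- cancels.
  have h1 := hA.inner_sq_le (A x) x
  rw [real_inner_self_eq_norm_sq] at h1
  have h3 := hA.inner_nonneg_right x
  have h4 := hA.inner_nonneg_right (A x)
  have h5 : ⟪x, A x⟫ ≤ ‖A x‖ := by simpa [hx] using real_inner_le_norm x (A x)
  rcases h3.eq_or_lt with h0 | h0
  · rw [← h0]; simpa using h4
  · have h6 : ⟪x, A x⟫ ^ 2 ≤ ‖A x‖ ^ 2 := by gcongr
    have h7 : ⟪x, A x⟫ ^ 2 * ‖A x‖ ^ 2 ≤ (‖A x‖ ^ 2) ^ 2 := by nlinarith [sq_nonneg ‖A x‖]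
    nlinarith

theorem LinearMap.IsPositive.inner_le_norm_sq {A : E →ₗ[ℝ] E}
    (hA1 : (LinearMap.id - A).IsPositive) (x : E) : ⟪x, A x⟫ ≤ ‖x‖ ^ 2 := by
  have := hA1.inner_nonneg_right x
  simp only [LinearMap.sub_apply, LinearMap.id_apply, inner_sub_right,
    real_inner_self_eq_norm_sq] at this
  linarith

/-- One perturbed power step moves the square root of the defect `1 - ⟪a, A a⟫` up by at most
three times the size of the perturbation. -/
theorem LinearMap.IsPositive.sqrt_defect_step {A : E →ₗ[ℝ] E} (hA : A.IsPositive)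
    (hA1 : (LinearMap.id - A).IsPositive) {a g a' : E} (ha : ‖a‖ = 1)
    (hD : √(1 - ⟪a, A a⟫) ≤ 1 / 2) (hg : ‖g‖ ≤ 1 / 4)
    (ha' : a' = ‖A a + g‖⁻¹ • (A a + g)) :
    √(1 - ⟪a', A a'⟫) ≤ √(1 - ⟪a, A a⟫) + 3 * ‖g‖ := by
  have hBf : ∀ x : E, ⟪x, (LinearMap.id - A : E →ₗ[ℝ] E) x⟫ = ‖x‖ ^ 2 - ⟪x, A x⟫ := fun x => by
    simp only [LinearMap.sub_apply, LinearMap.id_apply, inner_sub_right,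
      real_inner_self_eq_norm_sq]
  set D := √(1 - ⟪a, A a⟫) with hDdef
  have hD0 : 0 ≤ D := Real.sqrt_nonneg _
  have hDsq : D ^ 2 = 1 - ⟪a, A a⟫ := Real.sq_sqrt (by
    have := LinearMap.IsPositive.inner_le_norm_sq hA1 a
    rw [ha] at this; linarith)
  have hin : 3 / 4 ≤ ⟪a, A a⟫ := by nlinarith
  have hAa : 3 / 4 ≤ ‖A a‖ := by
    have : ⟪a, A a⟫ ≤ ‖A a‖ := by simpa [ha] using real_inner_le_norm a (A a)
    linarith
  have hw : ‖A a‖ - ‖g‖ ≤ ‖A a + g‖ := by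
    have := norm_sub_le (A a + g) g
    simp only [add_sub_cancel_right] at this
    linarith
  have hwpos : 1 / 2 ≤ ‖A a + g‖ := by linarith
  set w := A a + g with hwdef
  -- The exact step does not lower the Rayleigh quotient, so the normalised `A a` has a defect of at
  -- most `D²`.
  have hb1 : √(‖A a‖ ^ 2 - ⟪A a, A (A a)⟫) ≤ ‖A a‖ * D := by
    apply Real.sqrt_le_iff.2 ⟨by positivity, ?_⟩
    rw [mul_pow, hDsq]
    have := hA.inner_mul_norm_sq_le ha
    linarith
  have hb2 : √(‖g‖ ^ 2 - ⟪g, A g⟫) ≤ ‖g‖ := by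
    apply Real.sqrt_le_iff.2 ⟨by positivity, ?_⟩
    have := hA.inner_nonneg_right g
    linarith
  have hb3 : √(‖w‖ ^ 2 - ⟪w, A w⟫) ≤ ‖A a‖ * D + ‖g‖ := by
    have := hA1.sqrt_inner_add_le (A a) g
    rw [hBf, hBf, hBf] at this
    linarith
  have hfin : √(1 - ⟪a', A a'⟫) = ‖w‖⁻¹ * √(‖w‖ ^ 2 - ⟪w, A w⟫) := by
    have hw0 : 0 < ‖w‖ := by linarith
    rw [ha', map_smul, real_inner_smul_left, real_inner_smul_right,
      show (1 : ℝ) - ‖w‖⁻¹ * (‖w‖⁻¹ * ⟪w, A w⟫) = (‖w‖⁻¹) ^ 2 * (‖w‖ ^ 2 - ⟪w, A w⟫) by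
        field_simp, Real.sqrt_mul (by positivity), Real.sqrt_sq (by positivity)]
  -- The constant 3: `‖w‖ D ≥ ‖A a‖ D - ‖g‖ D` and `3 ‖w‖ ‖g‖ ≥ (3/2) ‖g‖`, while `D ≤ 1/2`.
  rw [hfin, inv_mul_le_iff₀ (by linarith)]
  have h0 := norm_nonneg g
  nlinarith [mul_nonneg h0 hD0]

/-- Deterministic analysis of the perturbed power method without a spectral gap: if the total
perturbation is small, and its total component along a top eigenvector `v` is small compared with
the overlap of `v` with the initial vector, then the last iterate is almost optimal. -/
theorem perturbed_power_method {A : E →ₗ[ℝ] E} (hA : A.IsPositive)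
    (hA1 : (LinearMap.id - A).IsPositive) {v : E} (hv1 : ‖v‖ = 1) (hv : A v = v)
    {a g : ℕ → E} {L : ℕ} {e : ℝ} (he : e ≤ 1 / 2) (ha0 : ‖a 0‖ = 1)
    (ha : ∀ l < L, a (l + 1) = ‖A (a l) + g l‖⁻¹ • (A (a l) + g l))
    (hu : 0 < |⟪v, a 0⟫|)
    (hg : ∑ l ∈ Finset.range L, ‖g l‖ ≤ e / 6)
    (hgv : ∑ l ∈ Finset.range L, |⟪v, g l⟫| ≤ |⟪v, a 0⟫| / 4)
    (hL : 1 + Real.log (4 / |⟪v, a 0⟫|) < L * (e ^ 2 / 8)) :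
    1 - ⟪a L, A (a L)⟫ ≤ e ^ 2 := by
  have he0 : 0 ≤ e := by
    have : 0 ≤ ∑ l ∈ Finset.range L, ‖g l‖ := Finset.sum_nonneg fun _ _ => norm_nonneg _
    linarith
  -- Thus `β l • a l` is the iterate without normalisation, driven by the errors `β l • g l`.
  set β : ℕ → ℝ := fun l => ∏ k ∈ Finset.range l, ‖A (a k) + g k‖ with hβ
  have hβ0 : ∀ l, 0 ≤ β l := fun l => Finset.prod_nonneg fun _ _ => norm_nonneg _
  have hβs : ∀ l, β (l + 1) = β l * ‖A (a l) + g l‖ := fun l => Finset.prod_range_succ _ _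
  have hle1 : ∀ l ≤ L, ‖a l‖ ≤ 1 := by
    intro l hl
    cases l with
    | zero => exact ha0.le
    | succ k =>
      rw [ha k (by omega), norm_smul, norm_inv, norm_norm]
      exact inv_mul_le_one
  have hAle : ∀ l ≤ L, ‖A (a l)‖ ≤ 1 := fun l hl => by
    have h1 := hA.norm_apply_sq_le hA1 (a l)
    have h2 := LinearMap.IsPositive.inner_le_norm_sq hA1 (a l)
    have h3 := hle1 l hl
    have h4 := norm_nonneg (a l)
    nlinarith [norm_nonneg (A (a l))]
  have hsub : ∀ (f : ℕ → ℝ), (∀ l, 0 ≤ f l) → ∀ l ≤ L,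
      ∑ k ∈ Finset.range l, f k ≤ ∑ k ∈ Finset.range L, f k := fun f hf l hl =>
    Finset.sum_le_sum_of_subset_of_nonneg (Finset.range_mono hl) fun i _ _ => hf i
  -- growth of the unnormalized iterates
  have hβle : ∀ l ≤ L, β l ≤ 3 := by
    have : ∀ l ≤ L, β l ≤ Real.exp (∑ k ∈ Finset.range l, ‖g k‖) := by
      intro l hl
      rw [Real.exp_sum]
      apply Finset.prod_le_prod (fun _ _ => norm_nonneg _)
      intro k hk
      have hk' := Finset.mem_range.1 hk
      have h1 := norm_add_le (A (a k)) (g k)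
      have h2 := hAle k (by omega)
      have h3 := Real.add_one_le_exp ‖g k‖
      linarith
    intro l hl
    refine (this l hl).trans ((Real.exp_le_exp.2 (?_ : _ ≤ (1 : ℝ))).trans
      Real.exp_one_lt_three.le)
    have := hsub (fun k => ‖g k‖) (fun _ => norm_nonneg _) l hl
    linarith
  have hrec : ∀ l < L, β (l + 1) • a (l + 1) = β l • (A (a l) + g l) := by
    intro l hl
    rw [hβs, ha l hl, smul_smul]
    rcases eq_or_ne (A (a l) + g l) 0 with h0 | h0
    · simp [h0]
    · rw [mul_assoc, mul_inv_cancel₀ (norm_ne_zero_iff.2 h0), mul_one]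
  have hAv : ∀ x, ⟪v, A x⟫ = ⟪v, x⟫ := fun x => by rw [← hA.isSymmetric v x, hv]
  -- `A` fixes `v`, so only the errors change the unnormalised overlap, by at most `3 |⟪v, g l⟫|`
  -- each. Their total is at most three quarters of the initial overlap.
  have huu : ∀ l ≤ L, |⟪v, a 0⟫| - 3 * ∑ k ∈ Finset.range l, |⟪v, g k⟫|
      ≤ β l * |⟪v, a l⟫| := by
    intro l
    induction l with
    | zero => intro _; simp [hβ]
    | succ l ih =>
      intro hl
      have h1 := ih (by omega)
      have h2 := congrArg (fun x => |⟪v, x⟫|) (hrec l (by omega))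
      simp only [real_inner_smul_right, inner_add_right, hAv, abs_mul, abs_of_nonneg (hβ0 _)]
        at h2
      rw [h2, Finset.sum_range_succ]
      have h3 : |⟪v, a l⟫| - |⟪v, g l⟫| ≤ |⟪v, a l⟫ + ⟪v, g l⟫| := by
        have := abs_sub_abs_le_abs_sub ⟪v, a l⟫ (-⟪v, g l⟫)
        rwa [abs_neg, sub_neg_eq_add] at this
      have h4 := mul_le_mul_of_nonneg_left h3 (hβ0 l)
      have h5 := mul_le_mul_of_nonneg_right (hβle l (by omega)) (abs_nonneg ⟪v, g l⟫)
      linarith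
  have hpos : ∀ l ≤ L, |⟪v, a 0⟫| / 4 ≤ β l * |⟪v, a l⟫| := fun l hl => by
    have h1 := huu l hl
    have h2 := hsub (fun k => |⟪v, g k⟫|) (fun _ => abs_nonneg _) l hl
    linarith
  -- The positive overlap excludes the degenerate normalisation `0⁻¹ • 0 = 0`.
  have hunit : ∀ l ≤ L, ‖a l‖ = 1 := by
    intro l hl
    cases l with
    | zero => exact ha0
    | succ k =>
      have h1 := hpos (k + 1) hl
      have h2 : A (a k) + g k ≠ 0 := by
        intro h0
        rw [hβs, h0] at h1
        simp only [norm_zero, mul_zero, zero_mul] at h1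
        linarith
      rw [ha k (by omega), norm_smul, norm_inv, norm_norm, inv_mul_cancel₀ (norm_ne_zero_iff.2 h2)]
  have hgl : ∀ l < L, ‖g l‖ ≤ 1 / 4 := fun l hl => by
    have := Finset.single_le_sum (f := fun l => ‖g l‖) (fun _ _ => norm_nonneg _)
      (Finset.mem_range.2 hl)
    linarith
  -- some iterate has a small defect
  obtain ⟨l₀, hl₀, hD₀⟩ : ∃ l < L, 1 - ⟪a l, A (a l)⟫ < e ^ 2 / 4 := by
    by_contra! hcon
    -- If all defects are at least `e²/4`, then `‖A a‖² ≤ ⟪a, A a⟫ ≤ 1 - e²/4 ≤ (1 - e²/8)²`. The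
    -- resulting decay of `β L` contradicts `β L ≥ |⟪v, a 0⟫| / 4`; the summand 1 in `hL` absorbs `∑
    -- ‖g l‖`.
    have hup : β L ≤ Real.exp (∑ k ∈ Finset.range L, (‖g k‖ - e ^ 2 / 8)) := by
      rw [Real.exp_sum]
      apply Finset.prod_le_prod (fun _ _ => norm_nonneg _)
      intro k hk
      have hk' := Finset.mem_range.1 hk
      have h1 := norm_add_le (A (a k)) (g k)
      have h2 := hA.norm_apply_sq_le hA1 (a k)
      have h3 := hcon k hk'
      have h4 : ‖A (a k)‖ ≤ 1 - e ^ 2 / 8 := by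
        apply abs_le_of_sq_le_sq' _ (by nlinarith) |>.2
        nlinarith [sq_nonneg (e ^ 2 / 8)]
      have h5 := Real.add_one_le_exp (‖g k‖ - e ^ 2 / 8)
      linarith
    have hvn : |⟪v, a 0⟫| / 4 ≤ β L * |⟪v, a L⟫| := hpos L le_rfl
    have h1 : |⟪v, a L⟫| ≤ 1 := by
      simpa [hv1, hunit L le_rfl] using abs_real_inner_le_norm v (a L)
    have h2 : |⟪v, a 0⟫| / 4 ≤ β L := hvn.trans (mul_le_of_le_one_right (hβ0 L) h1)
    rw [Finset.sum_sub_distrib, Finset.sum_const, Finset.card_range, nsmul_eq_mul] at hup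
    have h3 := Real.log_le_log (by positivity) (h2.trans hup)
    rw [Real.log_exp, ← inv_div, Real.log_inv] at h3
    linarith
  -- the defect stays small from then on
  have hstay : ∀ k, l₀ + k ≤ L → √(1 - ⟪a (l₀ + k), A (a (l₀ + k))⟫)
      ≤ e / 2 + 3 * ∑ j ∈ Finset.range (l₀ + k), ‖g j‖ := by
    intro k
    induction k with
    | zero =>
      intro _
      have h1 : √(1 - ⟪a l₀, A (a l₀)⟫) ≤ e / 2 :=
        Real.sqrt_le_iff.2 ⟨by positivity, by nlinarith⟩
      have h2 : 0 ≤ ∑ j ∈ Finset.range l₀, ‖g j‖ := Finset.sum_nonneg fun _ _ => norm_nonneg _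
      simp only [add_zero]
      linarith
    | succ k ih =>
      intro hk
      have h1 := ih (by omega)
      have h2 := hsub (fun k => ‖g k‖) (fun _ => norm_nonneg _) (l₀ + k) (by omega)
      have h3 := hA.sqrt_defect_step hA1 (hunit (l₀ + k) (by omega)) (by linarith)
        (hgl (l₀ + k) (by omega)) (ha (l₀ + k) (by omega))
      rw [← add_assoc, Finset.sum_range_succ]
      linarith
  have hfin := hstay (L - l₀) (by omega)
  rw [show l₀ + (L - l₀) = L by omega] at hfin
  -- The budget is `e/2` at the good iterate plus `3 · e/6` for the errors.
  have h1 : √(1 - ⟪a L, A (a L)⟫) ≤ e := by linarith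
  exact (Real.sqrt_le_iff.1 h1).2

end PositiveForms

/-! ### Anti-concentration on the sphere. -/

section Sphere

open Metric Set
open scoped Pointwise ENNReal

/-- A thin slab of the unit ball orthogonal to a unit vector `v` has small volume: shrunk and
translated copies of it fit disjointly into the ball. -/
theorem volume_slab_le {d N : ℕ} (hd : 1 ≤ d) (hN : 1 ≤ N) {v : Vec d} (hv : ‖v‖ = 1) {s : ℝ}
    (hs : 0 < s) (hsN : s ^ 2 * (16 * N ^ 2 * d) ≤ 1) :
    (N : ℝ≥0∞) * volume {x : Vec d | ‖x‖ < 1 ∧ |inner ℝ v x| < s}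
      ≤ 2 * volume (ball (0 : Vec d) 1) := by
  have hd0 : (1 : ℝ) ≤ d := by exact_mod_cast hd
  have hN0 : (1 : ℝ) ≤ N := by exact_mod_cast hN
  set S : Set (Vec d) := {x | ‖x‖ < 1 ∧ |inner ℝ v x| < s} with hS
  have hSo : IsOpen S := by
    apply IsOpen.inter
    · exact isOpen_lt continuous_norm continuous_const
    · exact isOpen_lt (f := fun x : Vec d => |inner ℝ v x|) (by fun_prop) continuous_const
  -- By Bernoulli this shrinking costs at most half the volume, yet it leaves room `1/(2d)` in the
  -- squared norm, enough for a translation by `2 s k` with `k < N`.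
  set τ : ℝ := 1 - 1 / (2 * d) with hτ
  have hinv : 1 / (2 * (d : ℝ)) ≤ 1 / 2 := by
    apply one_div_le_one_div_of_le <;> linarith
  have hinv0 : 0 < 1 / (2 * (d : ℝ)) := by positivity
  have hτ0 : 0 < τ := by linarith
  have hτd : (1 / 2 : ℝ) ≤ τ ^ d := by
    have := one_add_mul_le_pow (a := -(1 / (2 * (d : ℝ)))) (by linarith) d
    rw [← sub_eq_add_neg] at this
    refine le_trans (le_of_eq ?_) this
    field_simp
    norm_num
  -- The centres are `2 s` apart along `v` and every copy stays within `s` of its centre in that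
  -- direction, so the copies are disjoint.
  let T : ℕ → Set (Vec d) := fun k => (fun x => (2 * s * k) • v + x) '' (τ • S)
  have hTo : ∀ k, IsOpen (T k) := fun k =>
    (Homeomorph.addLeft ((2 * s * k) • v)).isOpenMap _ (hSo.smul₀ hτ0.ne')
  have hTvol : ∀ k, volume (T k) = ENNReal.ofReal (τ ^ d) * volume S := by
    intro k
    have : T k = (fun x => -((2 * s * k) • v) + x) ⁻¹' (τ • S) := Set.image_add_left
    rw [this, measure_preimage_add, Measure.addHaar_smul]
    simp [abs_of_pos hτ0]
  have hvT : ∀ k x, x ∈ T k → |inner ℝ v x - 2 * s * k| < s := by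
    rintro k _ ⟨_, ⟨x, hx, rfl⟩, rfl⟩
    have h1 := hx.2
    simp only [inner_add_right, real_inner_smul_right, real_inner_self_eq_norm_sq, hv]
    rw [show 2 * s * (k : ℝ) * 1 ^ 2 + τ * inner ℝ v x - 2 * s * k = τ * inner ℝ v x by ring,
      abs_mul, abs_of_pos hτ0]
    nlinarith [abs_nonneg (inner ℝ v x)]
  have hTsub : ∀ k < N, T k ⊆ ball 0 1 := by
    rintro k hk _ ⟨_, ⟨x, hx, rfl⟩, rfl⟩
    rw [mem_ball_zero_iff]
    have h1 := hx.2
    have h0 := hx.1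
    have hk' : (k : ℝ) + 1 ≤ N := by exact_mod_cast hk
    have hk0 : (0 : ℝ) ≤ k := by positivity
    have h2 : ‖(2 * s * (k : ℝ)) • v + τ • x‖ ^ 2
        = (2 * s * k) ^ 2 + 2 * (2 * s * k) * τ * inner ℝ v x + τ ^ 2 * ‖x‖ ^ 2 := by
      rw [norm_add_sq_real, norm_smul, norm_smul, hv, real_inner_smul_left, real_inner_smul_right]
      simp only [Real.norm_eq_abs, mul_pow, sq_abs]
      ring
    have h3 : ‖(2 * s * (k : ℝ)) • v + τ • x‖ ^ 2 < 1 := by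
      rw [h2]
      have ha : (2 * s * k) * τ * inner ℝ v x ≤ (2 * s * k) * s := by
        have : τ * inner ℝ v x ≤ s := by
          have := (abs_lt.1 h1).2
          nlinarith [abs_nonneg (inner ℝ v x)]
        rw [mul_assoc]
        exact mul_le_mul_of_nonneg_left this (by positivity)
      have hb : τ ^ 2 * ‖x‖ ^ 2 < τ ^ 2 := by
        have : ‖x‖ ^ 2 < 1 := by nlinarith [norm_nonneg x]
        nlinarith [pow_pos hτ0 2]
      have hc : τ ^ 2 ≤ 1 - 1 / (2 * d) := by nlinarith
      have he : s ^ 2 * (8 * N ^ 2) ≤ 1 / (2 * d) := by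
        rw [le_div_iff₀ (by positivity)]
        nlinarith
      have hf : (k : ℝ) * (k + 1) ≤ N ^ 2 := by nlinarith
      nlinarith [mul_le_mul_of_nonneg_left hf (sq_nonneg s), sq_nonneg (s * N)]
    exact lt_of_pow_lt_pow_left₀ 2 zero_le_one (by simpa using h3)
  have hdisj : Set.PairwiseDisjoint (↑(Finset.range N)) T := by
    intro i _ j _ hij
    refine Set.disjoint_left.2 fun x hi hj => hij ?_
    have h1 := abs_lt.1 (hvT i x hi)
    have h2 := abs_lt.1 (hvT j x hj)
    by_contra hne
    rcases Nat.lt_or_gt_of_ne hne with h | h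
    · have : (i : ℝ) + 1 ≤ j := by exact_mod_cast h
      nlinarith
    · have : (j : ℝ) + 1 ≤ i := by exact_mod_cast h
      nlinarith
  have hsum : (N : ℝ≥0∞) * (ENNReal.ofReal (τ ^ d) * volume S) ≤ volume (ball (0 : Vec d) 1) := by
    calc (N : ℝ≥0∞) * (ENNReal.ofReal (τ ^ d) * volume S)
        = ∑ k ∈ Finset.range N, volume (T k) := by simp [hTvol]
      _ = volume (⋃ k ∈ Finset.range N, T k) :=
          (measure_biUnion_finset hdisj fun k _ => (hTo k).measurableSet).symm
      _ ≤ _ := measure_mono (Set.iUnion₂_subset fun k hk => hTsub k (Finset.mem_range.1 hk))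
  calc (N : ℝ≥0∞) * volume S = 2 * (N * (ENNReal.ofReal (1 / 2) * volume S)) := by
        rw [mul_left_comm, ← mul_assoc 2, show (2 : ℝ≥0∞) * ENNReal.ofReal (1 / 2) = 1 by
          rw [← ENNReal.ofReal_ofNat 2, ← ENNReal.ofReal_mul (by norm_num)]; norm_num, one_mul]
    _ ≤ 2 * (N * (ENNReal.ofReal (τ ^ d) * volume S)) := by gcongr
    _ ≤ _ := by gcongr

theorem ae_norm_eq_one_uniformSphere (d : ℕ) : ∀ᵐ a ∂(uniformSphere d), ‖a‖ = 1 := by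
  unfold uniformSphere
  rw [ae_map_iff (by fun_prop) (measurableSet_eq_fun (by fun_prop) (by fun_prop))]
  exact Filter.Eventually.of_forall fun x => mem_sphere_zero_iff_norm.1 x.2

/-- Anti-concentration of a coordinate of a uniformly distributed unit vector. -/
theorem uniformSphere_abs_inner_lt_le {d N : ℕ} (hd : 1 ≤ d) (hN : 1 ≤ N) {v : Vec d}
    (hv : ‖v‖ = 1) {s : ℝ} (hs : 0 < s) (hsN : s ^ 2 * (16 * N ^ 2 * d) ≤ 1) :
    (uniformSphere d).real {a | |inner ℝ v a| < s} ≤ 2 / N := by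
  have hmeas : MeasurableSet {a : Vec d | |inner ℝ v a| < s} :=
    (isOpen_lt (by fun_prop) continuous_const).measurableSet
  have hB0 : volume (ball (0 : Vec d) 1) ≠ 0 := (measure_ball_pos _ _ one_pos).ne'
  have hBt : volume (ball (0 : Vec d) 1) ≠ ⊤ := measure_ball_lt_top.ne
  have hd0 : (d : ℝ≥0∞) ≠ 0 := by simp; omega
  have hN0 : (N : ℝ≥0∞) ≠ 0 := by simp; omega
  have hle : uniformSphere d {a | |inner ℝ v a| < s} ≤ 2 / N := by
    unfold uniformSphere
    rw [Measure.map_apply (by fun_prop) hmeas, Measure.smul_apply,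
      Measure.toSphere_apply' _ (hmeas.preimage measurable_subtype_coe),
      Measure.toSphere_apply_univ, smul_eq_mul]
    -- The surface measure of a set is `d` times the volume of the cone over it, and the cone over
    -- the thin band lies in the slab.
    have hsub : (Ioo (0 : ℝ) 1 • ((↑) '' ((↑) ⁻¹' {a : Vec d | |inner ℝ v a| < s} :
        Set (sphere (0 : Vec d) 1)) : Set (Vec d)))
        ⊆ {x : Vec d | ‖x‖ < 1 ∧ |inner ℝ v x| < s} := by
      rintro _ ⟨r, hr, _, ⟨x, hx, rfl⟩, rfl⟩
      have hx1 : ‖(x : Vec d)‖ = 1 := mem_sphere_zero_iff_norm.1 x.2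
      have hx2 : |inner ℝ v (x : Vec d)| < s := hx
      refine ⟨?_, ?_⟩
      · simp only [norm_smul, hx1, Real.norm_eq_abs, abs_of_pos hr.1, mul_one]
        exact hr.2
      · simp only [real_inner_smul_right, abs_mul, abs_of_pos hr.1]
        nlinarith [hr.1, hr.2, abs_nonneg (inner ℝ v (x : Vec d))]
    have h1 := (mul_le_mul_right (measure_mono hsub) (N : ℝ≥0∞)).trans
      (volume_slab_le hd hN hv hs hsN)
    rw [ENNReal.le_div_iff_mul_le (Or.inl hN0) (Or.inl (by simp))]
    simp only [finrank_euclideanSpace, Fintype.card_fin]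
    rw [ENNReal.mul_inv (Or.inl hd0) (Or.inl (by simp))]
    calc _ = ((d : ℝ≥0∞)⁻¹ * d) * (volume (ball (0 : Vec d) 1))⁻¹ * (N * volume _) := by ring
      _ ≤ ((d : ℝ≥0∞)⁻¹ * d) * (volume (ball (0 : Vec d) 1))⁻¹
            * (2 * volume (ball (0 : Vec d) 1)) := by gcongr
      _ = ((d : ℝ≥0∞)⁻¹ * d) * ((volume (ball (0 : Vec d) 1))⁻¹
            * volume (ball (0 : Vec d) 1)) * 2 := by ring
      _ = 2 := by
        rw [ENNReal.inv_mul_cancel hd0 (by simp), ENNReal.inv_mul_cancel hB0 hBt]; ring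
  have h2 := ENNReal.toReal_mono (ENNReal.div_ne_top (by simp) hN0) hle
  simpa [Measure.real] using h2

end Sphere

/-! ### Moments of the Gaussian conditioned on the unit ball. -/

section Gaussian

open Metric Set
open scoped ENNReal

local notation "⟪" x ", " y "⟫" => inner ℝ x y

instance isProbabilityMeasure_gaussianVec (d : ℕ) (m : ℝ) :
    IsProbabilityMeasure (gaussianVec d m) :=
  Measure.isProbabilityMeasure_map (by fun_prop)

theorem gaussianVec_map (d : ℕ) (m : ℝ) (U : Vec d ≃ₗᵢ[ℝ] Vec d) :
    (gaussianVec d m).map U = gaussianVec d m := by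
  unfold gaussianVec
  rw [Measure.map_map (by fun_prop) (by fun_prop)]
  conv_rhs => rw [← stdGaussian_map U]
  rw [Measure.map_map (by fun_prop) (by fun_prop)]
  congr 1
  ext x : 1
  simp

theorem exp_sq_gaussianReal :
    Integrable (fun x : ℝ => Real.exp (x ^ 2 / 4)) (gaussianReal 0 1) ∧
      ∫ x, Real.exp (x ^ 2 / 4) ∂(gaussianReal 0 1) = √2 := by
  have hform : ∀ x : ℝ, gaussianPDFReal 0 1 x * Real.exp (x ^ 2 / 4)
      = (√(2 * Real.pi))⁻¹ * Real.exp (-(1 / 4) * x ^ 2) := fun x => by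
    rw [gaussianPDFReal, mul_assoc, ← Real.exp_add]
    simp only [NNReal.coe_one, mul_one, sub_zero]
    congr 2
    ring
  constructor
  · rw [gaussianReal_of_var_ne_zero _ one_ne_zero,
      integrable_withDensity_iff (measurable_gaussianPDF _ _)
        (Filter.Eventually.of_forall fun _ => gaussianPDF_lt_top)]
    have : (fun x : ℝ => Real.exp (x ^ 2 / 4) * (gaussianPDF 0 1 x).toReal)
        = fun x => (√(2 * Real.pi))⁻¹ * Real.exp (-(1 / 4) * x ^ 2) := by
      ext x
      rw [toReal_gaussianPDF, mul_comm, hform]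
    rw [this]
    exact (integrable_exp_neg_mul_sq (by norm_num)).const_mul _
  · rw [integral_gaussianReal_eq_integral_smul one_ne_zero]
    simp only [smul_eq_mul, hform]
    rw [integral_const_mul, integral_gaussian, ← Real.sqrt_inv, ← Real.sqrt_mul (by positivity)]
    congr 1
    field_simp
    norm_num

/-- The exponential factors over the coordinates, each contributing `√2`. Both tail bounds outside
the unit ball come from this moment. -/
theorem exp_norm_sq_gaussianVec (d : ℕ) {m : ℝ} (hm : 0 < m) :
    Integrable (fun z => Real.exp (m * ‖z‖ ^ 2 / 4)) (gaussianVec d m) ∧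
      ∫ z, Real.exp (m * ‖z‖ ^ 2 / 4) ∂(gaussianVec d m) = √2 ^ d := by
  have hcomp : (fun z : Vec d => Real.exp (m * ‖z‖ ^ 2 / 4)) ∘ (fun x : Vec d => (√m)⁻¹ • x) ∘
      (WithLp.toLp 2 : (Fin d → ℝ) → Vec d) = fun x => ∏ i, Real.exp (x i ^ 2 / 4) := by
    ext x
    have h : ‖(√m)⁻¹ • (WithLp.toLp 2 x : Vec d)‖ ^ 2 = m⁻¹ * ∑ i, x i ^ 2 := by
      rw [norm_smul, mul_pow, EuclideanSpace.norm_sq_eq]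
      simp [Real.sq_sqrt hm.le]
    simp only [Function.comp_apply]
    rw [h, ← mul_assoc, mul_inv_cancel₀ hm.ne', one_mul, ← Real.exp_sum, Finset.sum_div]
  have hlaw : gaussianVec d m = (Measure.pi fun _ : Fin d => gaussianReal 0 1).map
      ((fun x : Vec d => (√m)⁻¹ • x) ∘ (WithLp.toLp 2 : (Fin d → ℝ) → Vec d)) := by
    unfold gaussianVec
    rw [← map_pi_eq_stdGaussian, Measure.map_map (by fun_prop) (by fun_prop)]
  constructor
  · rw [hlaw, integrable_map_measure (by fun_prop) (by fun_prop), hcomp]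
    exact Integrable.fintype_prod fun _ => exp_sq_gaussianReal.1
  · rw [hlaw, integral_map (by fun_prop) (by fun_prop)]
    have := congrArg (fun f => ∫ x, f x ∂(Measure.pi fun _ : Fin d => gaussianReal 0 1)) hcomp
    simp only [Function.comp_apply] at this ⊢
    rw [this, integral_fintype_prod_eq_pow (fun x : ℝ => Real.exp (x ^ 2 / 4)),
      exp_sq_gaussianReal.2, Fintype.card_fin]

theorem integrable_norm_sq_gaussianVec (d : ℕ) (m : ℝ) :
    Integrable (fun z => ‖z‖ ^ 2) (gaussianVec d m) := by
  unfold gaussianVec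
  rw [integrable_map_measure (by fun_prop) (by fun_prop)]
  have h : Integrable (fun x : Vec d => ‖x‖ ^ 2) (stdGaussian (Vec d)) :=
    (IsGaussian.memLp_two_id (μ := stdGaussian (Vec d))).norm.integrable_sq
  convert h.const_mul (‖(√m)⁻¹‖ ^ 2) using 2
  simp [norm_smul, mul_pow]

theorem integral_inner_sq_gaussianVec {d : ℕ} {m : ℝ} (hm : 0 < m) (v : Vec d) :
    ∫ z, ⟪v, z⟫ ^ 2 ∂(gaussianVec d m) = ‖v‖ ^ 2 / m := by
  unfold gaussianVec
  rw [integral_map (by fun_prop) (by fun_prop)]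
  have h := variance_dual_stdGaussian (E := Vec d) (innerSL ℝ v)
  rw [variance_of_integral_eq_zero (by fun_prop) (integral_strongDual_stdGaussian _)] at h
  simp only [innerSL_apply_apply, innerSL_apply_norm] at h
  simp only [real_inner_smul_right, mul_pow, inv_pow, Real.sq_sqrt hm.le]
  rw [integral_const_mul, h]
  field_simp

theorem integral_norm_sq_gaussianVec (d : ℕ) {m : ℝ} (hm : 0 < m) :
    ∫ z, ‖z‖ ^ 2 ∂(gaussianVec d m) = d / m := by
  have h : ∀ z : Vec d, ‖z‖ ^ 2 = ∑ i, ⟪EuclideanSpace.basisFun (Fin d) ℝ i, z⟫ ^ 2 := fun z => by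
    rw [← (EuclideanSpace.basisFun (Fin d) ℝ).sum_sq_norm_inner_right z]
    simp
  simp_rw [h]
  rw [integral_finsetSum]
  · simp_rw [integral_inner_sq_gaussianVec hm, (EuclideanSpace.basisFun (Fin d) ℝ).norm_eq_one]
    simp [div_eq_mul_inv]
  · intro i _
    refine (integrable_norm_sq_gaussianVec d m).mono' (by fun_prop) (.of_forall fun z => ?_)
    rw [Real.norm_eq_abs, abs_of_nonneg (sq_nonneg _), ← sq_abs]
    gcongr
    simpa [(EuclideanSpace.basisFun (Fin d) ℝ).norm_eq_one] using
      abs_real_inner_le_norm (EuclideanSpace.basisFun (Fin d) ℝ i) z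

/-- Gaussian tail bound. -/
theorem gaussianVec_compl_ball_le (d : ℕ) {m : ℝ} (hm : 0 < m) :
    (gaussianVec d m).real (closedBall 0 1)ᶜ ≤ √2 ^ d * Real.exp (-(m / 4)) := by
  have h := mul_meas_ge_le_integral_of_nonneg (μ := gaussianVec d m)
    (.of_forall fun z => (Real.exp_pos (m * ‖z‖ ^ 2 / 4)).le) (exp_norm_sq_gaussianVec d hm).1
    (Real.exp (m / 4))
  rw [(exp_norm_sq_gaussianVec d hm).2] at h
  have hsub : (gaussianVec d m).real (closedBall 0 1)ᶜ
      ≤ (gaussianVec d m).real {z | Real.exp (m / 4) ≤ Real.exp (m * ‖z‖ ^ 2 / 4)} := by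
    refine measureReal_mono (fun z hz => ?_) (measure_ne_top _ _)
    have hz : 1 < ‖z‖ := by simpa using hz
    simp only [mem_ofPred_eq, Real.exp_le_exp]
    nlinarith [mul_le_mul_of_nonneg_left (one_le_pow₀ hz.le : (1 : ℝ) ≤ ‖z‖ ^ 2) hm.le]
  rw [Real.exp_neg, ← div_eq_mul_inv, le_div_iff₀ (Real.exp_pos _), mul_comm]
  exact (mul_le_mul_of_nonneg_left hsub (Real.exp_pos _).le).trans h

/-- The part of the second moment outside the unit ball. -/
theorem setIntegral_norm_sq_compl_ball_le (d : ℕ) {m : ℝ} (hm : 0 < m) :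
    ∫ z in (closedBall 0 1)ᶜ, ‖z‖ ^ 2 ∂(gaussianVec d m)
      ≤ 8 * (√2 ^ d * Real.exp (-(m / 8))) / m := by
  have hint := (exp_norm_sq_gaussianVec d hm)
  calc ∫ z in (closedBall 0 1)ᶜ, ‖z‖ ^ 2 ∂(gaussianVec d m)
      ≤ ∫ z in (closedBall 0 1)ᶜ, 8 * Real.exp (-(m / 8)) / m * Real.exp (m * ‖z‖ ^ 2 / 4)
          ∂(gaussianVec d m) := by
        apply setIntegral_mono_on (integrable_norm_sq_gaussianVec d m).integrableOn
          (hint.1.const_mul _).integrableOn measurableSet_closedBall.compl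
        intro z hz
        have hz : 1 < ‖z‖ := by simpa using hz
        rw [div_mul_eq_mul_div, le_div_iff₀ hm, mul_assoc, ← Real.exp_add]
        -- For `‖z‖ ≥ 1` one has `m‖z‖²/8 ≤ m‖z‖²/4 - m/8`, and the right side is below its
        -- exponential.
        have h1 := Real.add_one_le_exp (-(m / 8) + m * ‖z‖ ^ 2 / 4)
        have h2 : 0 ≤ m * (‖z‖ ^ 2 - 1) := mul_nonneg hm.le (by nlinarith)
        linarith
    _ ≤ ∫ z, 8 * Real.exp (-(m / 8)) / m * Real.exp (m * ‖z‖ ^ 2 / 4) ∂(gaussianVec d m) :=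
        setIntegral_le_integral (hint.1.const_mul _) (.of_forall fun z => by positivity)
    _ = _ := by rw [integral_const_mul, hint.2]; ring

/-- The Gaussian `N(0, I/m)` conditioned on the unit ball. -/
noncomputable def ballGaussian (d : ℕ) (m : ℝ) : Measure (Vec d) :=
  ProbabilityTheory.cond (gaussianVec d m) (closedBall 0 1)

theorem isProbabilityMeasure_ballGaussian {d : ℕ} {m : ℝ}
    (h : gaussianVec d m (closedBall 0 1) ≠ 0) : IsProbabilityMeasure (ballGaussian d m) :=
  cond_isProbabilityMeasure h

theorem ae_norm_le_ballGaussian (d : ℕ) (m : ℝ) : ∀ᵐ z ∂(ballGaussian d m), ‖z‖ ≤ 1 :=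
  (ae_cond_mem measurableSet_closedBall).mono fun z hz => by simpa using hz

/-- The ball is invariant under isometries, so truncation keeps the rotation invariance of the
Gaussian. That is why odd functions still integrate to zero and the covariance is still a multiple
of the identity. -/
theorem ballGaussian_map (d : ℕ) (m : ℝ) (U : Vec d ≃ₗᵢ[ℝ] Vec d) :
    (ballGaussian d m).map U = ballGaussian d m := by
  have hpre : U ⁻¹' closedBall 0 1 = closedBall 0 1 := by
    ext x; simp
  unfold ballGaussian ProbabilityTheory.cond
  rw [Measure.map_smul]
  congr 1
  conv_lhs => rw [← hpre]
  rw [← Measure.restrict_map (by fun_prop) measurableSet_closedBall, gaussianVec_map]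

theorem integral_comp_ballGaussian {d : ℕ} {m : ℝ} (U : Vec d ≃ₗᵢ[ℝ] Vec d) {F : Vec d → ℝ} :
    ∫ z, F (U z) ∂(ballGaussian d m) = ∫ z, F z ∂(ballGaussian d m) := by
  conv_rhs => rw [← ballGaussian_map d m U]
  exact (integral_map_equiv U.toHomeomorph.toMeasurableEquiv F).symm

theorem integral_ballGaussian_of_odd {d : ℕ} {m : ℝ} {F : Vec d → ℝ} (hF : ∀ z, F (-z) = -F z) :
    ∫ z, F z ∂(ballGaussian d m) = 0 := by
  have h := integral_comp_ballGaussian (m := m) (LinearIsometryEquiv.neg ℝ (E := Vec d)) (F := F)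
  simp only [LinearIsometryEquiv.coe_neg, hF, integral_neg] at h
  linarith

/-- The variance of every coordinate under `ballGaussian`. -/
noncomputable def ballVar (d : ℕ) (m : ℝ) : ℝ := (∫ z, ‖z‖ ^ 2 ∂(ballGaussian d m)) / d

theorem integrable_ballGaussian {d : ℕ} {m : ℝ} {F : Vec d → ℝ} (hF : Measurable F) {C : ℝ}
    (hC : ∀ z, ‖z‖ ≤ 1 → |F z| ≤ C) : Integrable F (ballGaussian d m) := by
  have : IsFiniteMeasure (ballGaussian d m) := by
    unfold ballGaussian; infer_instance
  refine Integrable.of_bound hF.aestronglyMeasurable C ?_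
  filter_upwards [ae_norm_le_ballGaussian d m] with z hz using hC z hz

theorem abs_inner_le_of_norm_le_one {d : ℕ} (v : Vec d) {z : Vec d} (hz : ‖z‖ ≤ 1) :
    |⟪v, z⟫| ≤ ‖v‖ :=
  (abs_real_inner_le_norm v z).trans (mul_le_of_le_one_right (norm_nonneg v) hz)

/-- A reflection exchanges two vectors of equal norm, so the second moment along `v` depends on
`‖v‖` alone; summing over an orthonormal basis identifies the factor. -/
theorem integral_inner_sq_ballGaussian {d : ℕ} (m : ℝ) (v : Vec d) :
    ∫ z, ⟪v, z⟫ ^ 2 ∂(ballGaussian d m) = ballVar d m * ‖v‖ ^ 2 := by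
  have hiso : ∀ u w : Vec d, ‖u‖ = ‖w‖ →
      ∫ z, ⟪u, z⟫ ^ 2 ∂(ballGaussian d m) = ∫ z, ⟪w, z⟫ ^ 2 ∂(ballGaussian d m) := by
    intro u w h
    rw [← integral_comp_ballGaussian (Submodule.reflection (ℝ ∙ (u - w))ᗮ) (F := fun z => ⟪w, z⟫ ^ 2)]
    congr 1 with z
    have h1 := LinearIsometryEquiv.inner_map_map (Submodule.reflection (ℝ ∙ (u - w))ᗮ) u z
    rw [Submodule.reflection_sub h] at h1
    rw [h1]
  have hsum : ∫ z, ‖z‖ ^ 2 ∂(ballGaussian d m)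
      = ∑ i, ∫ z, ⟪EuclideanSpace.basisFun (Fin d) ℝ i, z⟫ ^ 2 ∂(ballGaussian d m) := by
    rw [← integral_finsetSum]
    · congr 1 with z
      rw [← (EuclideanSpace.basisFun (Fin d) ℝ).sum_sq_norm_inner_right z]
      simp
    · intro i _
      refine integrable_ballGaussian (by fun_prop) (C := 1) fun z hz => ?_
      rw [abs_of_nonneg (sq_nonneg _), ← sq_abs]
      have h1 := abs_inner_le_of_norm_le_one (EuclideanSpace.basisFun (Fin d) ℝ i) hz
      rw [(EuclideanSpace.basisFun (Fin d) ℝ).norm_eq_one] at h1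
      exact pow_le_one₀ (abs_nonneg _) h1
  rcases Nat.eq_zero_or_pos d with rfl | hd
  · have : Subsingleton (Vec 0) := inferInstance
    rw [Subsingleton.elim v 0]; simp
  let i₀ : Fin d := ⟨0, hd⟩
  set b := EuclideanSpace.basisFun (Fin d) ℝ
  have hd0 : (d : ℝ) ≠ 0 := by positivity
  have hall : ∫ z, ‖z‖ ^ 2 ∂(ballGaussian d m) = d * ∫ z, ⟪b i₀, z⟫ ^ 2 ∂(ballGaussian d m) := by
    rw [hsum, Finset.sum_congr rfl fun i _ => hiso (b i) (b i₀)
      (by rw [b.norm_eq_one, b.norm_eq_one])]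
    simp
  have h1 := hiso v (‖v‖ • b i₀) (by rw [norm_smul, b.norm_eq_one]; simp)
  simp only [real_inner_smul_left, mul_pow] at h1
  rw [h1, integral_const_mul, ballVar, hall]
  field_simp

theorem integral_inner_mul_inner_ballGaussian {d : ℕ} (m : ℝ) (u w : Vec d) :
    ∫ z, ⟪u, z⟫ * ⟪w, z⟫ ∂(ballGaussian d m) = ballVar d m * ⟪u, w⟫ := by
  have hsq : ∀ v : Vec d, Integrable (fun z => ⟪v, z⟫ ^ 2) (ballGaussian d m) := fun v => by
    refine integrable_ballGaussian (by fun_prop) (C := ‖v‖ ^ 2) fun z hz => ?_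
    rw [abs_of_nonneg (sq_nonneg _), ← sq_abs]
    have := abs_inner_le_of_norm_le_one v hz
    gcongr
  have h : ∀ z, ⟪u, z⟫ * ⟪w, z⟫ = 1 / 4 * (⟪u + w, z⟫ ^ 2 - ⟪u - w, z⟫ ^ 2) := fun z => by
    rw [inner_add_left, inner_sub_left]; ring
  simp_rw [h]
  rw [integral_const_mul, integral_sub (hsq _) (hsq _), integral_inner_sq_ballGaussian,
    integral_inner_sq_ballGaussian, norm_add_sq_real, norm_sub_sq_real]
  ring

theorem ballVar_le {d : ℕ} (hd : 1 ≤ d) {m : ℝ} (hm : 0 < m)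
    (hp : 1 / 2 ≤ (gaussianVec d m).real (closedBall 0 1)) : ballVar d m ≤ 2 / m := by
  have hd0 : (0 : ℝ) < d := by exact_mod_cast hd
  have h1 : ∫ z, ‖z‖ ^ 2 ∂(ballGaussian d m)
      = ((gaussianVec d m).real (closedBall 0 1))⁻¹
        * ∫ z in closedBall 0 1, ‖z‖ ^ 2 ∂(gaussianVec d m) := by
    unfold ballGaussian ProbabilityTheory.cond
    rw [integral_smul_measure, ENNReal.toReal_inv]; rfl
  have h2 : ∫ z in closedBall 0 1, ‖z‖ ^ 2 ∂(gaussianVec d m) ≤ d / m := by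
    rw [← integral_norm_sq_gaussianVec d hm]
    exact setIntegral_le_integral (integrable_norm_sq_gaussianVec d m)
      (.of_forall fun z => by positivity)
  have h3 : ((gaussianVec d m).real (closedBall 0 1))⁻¹ ≤ 2 :=
    (inv_anti₀ (by norm_num) hp).trans (by norm_num)
  rw [ballVar, div_le_iff₀ hd0, h1]
  calc _ ≤ 2 * (d / m) := mul_le_mul h3 h2 (integral_nonneg fun z => by positivity) (by norm_num)
    _ = _ := by ring

/-- Truncation removes at most half of the second moment `d / m`, and dividing by a probability only
enlarges the rest. It follows that the factor `m * ballVar / 2` in front of `M a` is at least `1/4`.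
-/
theorem le_ballVar {d : ℕ} (hd : 1 ≤ d) {m : ℝ} (hm : 0 < m)
    (hp : 1 / 2 ≤ (gaussianVec d m).real (closedBall 0 1))
    (ht : 16 * (√2 ^ d * Real.exp (-(m / 8))) ≤ 1) : 1 / (2 * m) ≤ ballVar d m := by
  have hd0 : (1 : ℝ) ≤ d := by exact_mod_cast hd
  have h1 : ∫ z, ‖z‖ ^ 2 ∂(ballGaussian d m)
      = ((gaussianVec d m).real (closedBall 0 1))⁻¹
        * ∫ z in closedBall 0 1, ‖z‖ ^ 2 ∂(gaussianVec d m) := by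
    unfold ballGaussian ProbabilityTheory.cond
    rw [integral_smul_measure, ENNReal.toReal_inv]; rfl
  have h2 : d / (2 * m) ≤ ∫ z in closedBall 0 1, ‖z‖ ^ 2 ∂(gaussianVec d m) := by
    have h3 := integral_add_compl measurableSet_closedBall (integrable_norm_sq_gaussianVec d m)
      (s := closedBall 0 1)
    rw [integral_norm_sq_gaussianVec d hm] at h3
    have h4 := setIntegral_norm_sq_compl_ball_le d hm
    have h5 : 8 * (√2 ^ d * Real.exp (-(m / 8))) / m ≤ d / (2 * m) := by
      rw [div_le_div_iff₀ hm (by positivity)]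
      nlinarith
    have h6 : (d : ℝ) / m = d / (2 * m) + d / (2 * m) := by field_simp; norm_num
    linarith
  have h3 : 1 ≤ ((gaussianVec d m).real (closedBall 0 1))⁻¹ :=
    (one_le_inv₀ (by linarith)).2 measureReal_le_one
  rw [ballVar, le_div_iff₀ (by linarith), h1]
  have h0 : 0 ≤ d / (2 * m) := by positivity
  calc 1 / (2 * m) * d = 1 * (d / (2 * m)) := by ring
    _ ≤ _ := mul_le_mul h3 h2 h0 (by linarith)

/-- Conditioning a product of Gaussians on all members being in the ball yields a product. -/
theorem batchLaw_eq_pi {d n : ℕ} {m : ℝ} (h : gaussianVec d m (closedBall 0 1) ≠ 0) :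
    batchLaw d n m = Measure.pi fun _ => ballGaussian d m := by
  have := isProbabilityMeasure_ballGaussian h
  have hset : {z : Fin n → Vec d | ∀ i, ‖z i‖ ≤ 1} = univ.pi fun _ => closedBall 0 1 := by
    ext z; simp [Set.mem_pi]
  refine (Measure.pi_eq fun s hs => ?_).symm
  rw [batchLaw, hset, cond_apply (MeasurableSet.univ_pi fun _ => measurableSet_closedBall),
    ← Set.pi_inter_distrib, Measure.pi_pi, Measure.pi_pi]
  simp only [ballGaussian, cond_apply measurableSet_closedBall]
  rw [Finset.prod_mul_distrib]
  simp [ENNReal.inv_pow]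

theorem ae_norm_le_batchLaw (d n : ℕ) (m : ℝ) : ∀ᵐ z ∂(batchLaw d n m), ∀ i, ‖z i‖ ≤ 1 := by
  refine ae_cond_mem (s := {z : Fin n → Vec d | ∀ i, ‖z i‖ ≤ 1}) ?_
  have : {z : Fin n → Vec d | ∀ i, ‖z i‖ ≤ 1} = univ.pi fun _ => closedBall 0 1 := by
    ext z; simp [Set.mem_pi]
  rw [this]
  exact MeasurableSet.univ_pi fun _ => measurableSet_closedBall

end Gaussian

/-! ### Mean and variance of the estimator for a frozen iterate; martingale differences. -/

section Moments

open Metric Set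
open scoped ENNReal

local notation "⟪" x ", " y "⟫" => inner ℝ x y

theorem quadReward_eq_inner {d : ℕ} (M : Matrix (Fin d) (Fin d) ℝ) (a : Vec d) :
    quadReward M a = ⟪a, Matrix.toEuclideanLin M a⟫ := by
  rw [quadReward, EuclideanSpace.inner_eq_star_dotProduct, dotProduct_comm]
  simp

@[fun_prop]
theorem continuous_quadReward {d : ℕ} (M : Matrix (Fin d) (Fin d) ℝ) :
    Continuous (quadReward M) := by
  have h : quadReward M = fun a => ⟪a, Matrix.toEuclideanLin M a⟫ :=
    funext (quadReward_eq_inner M)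
  rw [h]
  exact continuous_id.inner (LinearMap.continuous_of_finiteDimensional _)

@[fun_prop]
theorem measurable_quadReward {d : ℕ} (M : Matrix (Fin d) (Fin d) ℝ) :
    Measurable (quadReward M) := (continuous_quadReward M).measurable

theorem norm_exploreAction_le {d : ℕ} {a z : Vec d} (ha : ‖a‖ ≤ 1) (hz : ‖z‖ ≤ 1) :
    ‖exploreAction a z‖ ≤ 1 := by
  rw [exploreAction, norm_smul]
  have := norm_add_le a z
  norm_num
  linarith

/-- The first summand is even in `z` and disappears after multiplication by `⟪w, z⟫` and
integration; the linear one carries `M a`. -/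
theorem quadReward_exploreAction {d : ℕ} {M : Matrix (Fin d) (Fin d) ℝ}
    (hM : (Matrix.toEuclideanLin M).IsPositive) (a z : Vec d) :
    quadReward M (exploreAction a z) =
      1 / 4 * (quadReward M a + quadReward M z) + 1 / 2 * ⟪Matrix.toEuclideanLin M a, z⟫ := by
  simp only [quadReward_eq_inner, exploreAction, map_smul, map_add, real_inner_smul_left,
    real_inner_smul_right, inner_add_left, inner_add_right]
  have h1 : ⟪a, Matrix.toEuclideanLin M z⟫ = ⟪Matrix.toEuclideanLin M a, z⟫ :=
    (hM.isSymmetric a z).symm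
  have h2 : ⟪z, Matrix.toEuclideanLin M a⟫ = ⟪Matrix.toEuclideanLin M a, z⟫ :=
    real_inner_comm _ _
  rw [h1, h2]
  ring

theorem quadReward_neg {d : ℕ} (M : Matrix (Fin d) (Fin d) ℝ) (a : Vec d) :
    quadReward M (-a) = quadReward M a := by
  simp [quadReward_eq_inner]

variable {d : ℕ} {M : Matrix (Fin d) (Fin d) ℝ}

/-- The correlation of the mean reward with the perturbation recovers `M a`. -/
theorem integral_quadReward_mul_inner (hM : (Matrix.toEuclideanLin M).IsPositive)
    (hf : ∀ x, ‖x‖ ≤ 1 → |quadReward M x| ≤ 1) {a : Vec d} (ha : ‖a‖ ≤ 1) (m : ℝ) (w : Vec d) :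
    ∫ z, quadReward M (exploreAction a z) * ⟪w, z⟫ ∂(ballGaussian d m)
      = ballVar d m / 2 * ⟪w, Matrix.toEuclideanLin M a⟫ := by
  set Ta := Matrix.toEuclideanLin M a
  have h : ∀ z, quadReward M (exploreAction a z) * ⟪w, z⟫
      = 1 / 4 * (quadReward M a + quadReward M z) * ⟪w, z⟫ + 1 / 2 * (⟪Ta, z⟫ * ⟪w, z⟫) :=
    fun z => by rw [quadReward_exploreAction hM]; ring
  simp_rw [h]
  rw [integral_add, integral_const_mul, integral_inner_mul_inner_ballGaussian,
    integral_ballGaussian_of_odd, real_inner_comm]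
  · ring
  · intro z
    rw [quadReward_neg, inner_neg_right]; ring
  · refine integrable_ballGaussian (by fun_prop) (C := 1 / 2 * ‖w‖) fun z hz => ?_
    rw [abs_mul]
    refine mul_le_mul ?_ (abs_inner_le_of_norm_le_one w hz) (abs_nonneg _) (by norm_num)
    have h1 := abs_le.1 (hf a ha)
    have h2 := abs_le.1 (hf z hz)
    rw [abs_le]
    constructor <;> linarith
  · refine Integrable.const_mul (integrable_ballGaussian (by fun_prop) (C := ‖Ta‖ * ‖w‖) fun z hz => ?_) _
    rw [abs_mul]
    exact mul_le_mul (abs_inner_le_of_norm_le_one _ hz) (abs_inner_le_of_norm_le_one w hz)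
      (abs_nonneg _) (norm_nonneg _)

/-- The sampling error of the mean-reward part of the estimator, in a fixed direction. -/
theorem integral_signal_sq_le (hM : (Matrix.toEuclideanLin M).IsPositive)
    (hf : ∀ x, ‖x‖ ≤ 1 → |quadReward M x| ≤ 1) {a : Vec d} (ha : ‖a‖ ≤ 1) {m : ℝ} (n : ℕ)
    (hp : gaussianVec d m (closedBall 0 1) ≠ 0) {w : Vec d} (hw : ‖w‖ = 1) :
    ∫⁻ z, ENNReal.ofReal ((∑ i : Fin n, quadReward M (exploreAction a (z i)) * ⟪w, z i⟫
        - n * (ballVar d m / 2 * ⟪w, Matrix.toEuclideanLin M a⟫)) ^ 2) ∂(batchLaw d n m)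
      ≤ ENNReal.ofReal (n * ballVar d m) := by
  have := isProbabilityMeasure_ballGaussian hp
  set φ : Vec d → ℝ := fun z => quadReward M (exploreAction a z) * ⟪w, z⟫ with hφ
  have hφm : Measurable φ := by
    have : Continuous (exploreAction a) := by unfold exploreAction; fun_prop
    have := this.measurable
    fun_prop
  have hφle : ∀ z, ‖z‖ ≤ 1 → |φ z| ≤ |⟪w, z⟫| := fun z hz => by
    rw [hφ, abs_mul]
    exact mul_le_of_le_one_left (abs_nonneg _) (hf _ (norm_exploreAction_le ha hz))
  have hφ1 : ∀ z, ‖z‖ ≤ 1 → |φ z| ≤ 1 := fun z hz =>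
    (hφle z hz).trans ((abs_inner_le_of_norm_le_one w hz).trans hw.le)
  have hφL : MemLp φ 2 (ballGaussian d m) := by
    refine MemLp.of_bound hφm.aestronglyMeasurable 1 ?_
    filter_upwards [ae_norm_le_ballGaussian d m] with z hz using hφ1 z hz
  -- Rewards are at most 1 in absolute value, so `φ²` is dominated by `⟪w, z⟫²`.
  have hvar : Var[φ; ballGaussian d m] ≤ ballVar d m := by
    refine (variance_le_expectation_sq hφm.aestronglyMeasurable).trans ?_
    have h1 := integral_inner_sq_ballGaussian m w
    rw [hw, one_pow, mul_one] at h1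
    rw [← h1]
    refine integral_mono_ae hφL.integrable_sq ?_ ?_
    · refine integrable_ballGaussian (by fun_prop) (C := 1) fun z hz => ?_
      rw [abs_of_nonneg (sq_nonneg _), ← sq_abs]
      exact pow_le_one₀ (abs_nonneg _) ((abs_inner_le_of_norm_le_one w hz).trans hw.le)
    · filter_upwards [ae_norm_le_ballGaussian d m] with z hz
      exact sq_le_sq.2 (hφle z hz)
  have hL : MemLp (∑ i : Fin n, fun z : Fin n → Vec d => φ (z i)) 2
      (Measure.pi fun _ : Fin n => ballGaussian d m) := by
    refine memLp_finsetSum' _ fun i _ => ?_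
    exact hφL.comp_measurePreserving (measurePreserving_eval _ i)
  have hmean : ∫ z, (∑ i : Fin n, fun z : Fin n → Vec d => φ (z i)) z
      ∂(Measure.pi fun _ : Fin n => ballGaussian d m)
      = n * (ballVar d m / 2 * ⟪w, Matrix.toEuclideanLin M a⟫) := by
    simp only [Finset.sum_apply]
    rw [integral_finsetSum]
    · have h1 : ∀ i : Fin n, ∫ z : Fin n → Vec d, φ (z i)
          ∂(Measure.pi fun _ : Fin n => ballGaussian d m)
          = ballVar d m / 2 * ⟪w, Matrix.toEuclideanLin M a⟫ := fun i => by
        have hmp := measurePreserving_eval (fun _ : Fin n => ballGaussian d m) i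
        rw [← integral_quadReward_mul_inner hM hf ha m w]
        conv_rhs => rw [← hmp.map_eq]
        rw [integral_map hmp.measurable.aemeasurable hφm.aestronglyMeasurable]
      simp [h1]
    · intro i _
      exact (hφL.comp_measurePreserving (measurePreserving_eval _ i)).integrable one_le_two
  rw [batchLaw_eq_pi hp]
  have hv := variance_eq_integral (μ := Measure.pi fun _ : Fin n => ballGaussian d m)
    hL.aestronglyMeasurable.aemeasurable
  rw [hmean, variance_sum_pi (fun _ => hφL)] at hv
  simp only [Finset.sum_apply] at hv
  rw [← ofReal_integral_eq_lintegral_ofReal _ (.of_forall fun _ => sq_nonneg _)]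
  · apply ENNReal.ofReal_le_ofReal
    rw [← hv]
    simp only [Finset.sum_const, Finset.card_univ, Fintype.card_fin, nsmul_eq_mul]
    gcongr
  · have := (hL.sub (memLp_const
      (n * (ballVar d m / 2 * ⟪w, Matrix.toEuclideanLin M a⟫)))).integrable_sq
    simpa using this

/-- Second moment of a sum of martingale differences. -/
theorem integral_sq_sum_le_of_condExp_eq_zero {Ω : Type*} [mΩ : MeasurableSpace Ω]
    {μ : Measure Ω} [IsProbabilityMeasure μ] {X : ℕ → Ω → ℝ} {H : ℕ → MeasurableSpace Ω}
    (hH : ∀ i, H i ≤ mΩ) {b : ℝ} (n : ℕ) (hX : ∀ i < n, MemLp (X i) 2 μ)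
    (hmeas : ∀ j < n, ∀ i < j, StronglyMeasurable[H j] (X i))
    (hzero : ∀ i < n, μ[X i | H i] =ᵐ[μ] 0) (hb : ∀ i < n, ∫ ω, X i ω ^ 2 ∂μ ≤ b) :
    MemLp (fun ω => ∑ i ∈ Finset.range n, X i ω) 2 μ ∧
      ∫ ω, (∑ i ∈ Finset.range n, X i ω) ^ 2 ∂μ ≤ n * b := by
  induction n with
  | zero => simp
  | succ n ih =>
    obtain ⟨h1, h2⟩ := ih (fun i hi => hX i (by omega)) (fun j hj => hmeas j (by omega))
      (fun i hi => hzero i (by omega)) (fun i hi => hb i (by omega))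
    set S : Ω → ℝ := fun ω => ∑ i ∈ Finset.range n, X i ω with hS
    have hXn := hX n (by omega)
    have hSm : StronglyMeasurable[H n] S :=
      Finset.stronglyMeasurable_fun_sum _ fun i hi => hmeas n (by omega) i (Finset.mem_range.1 hi)
    have hSX : Integrable (S * X n) μ := h1.integrable_mul hXn
    have hcross : ∫ ω, S ω * X n ω ∂μ = 0 := by
      have h3 := condExp_mul_of_stronglyMeasurable_left hSm hSX (hXn.integrable one_le_two)
      have h4 : ∫ ω, (S * X n) ω ∂μ = 0 := by
        rw [← integral_condExp (hH n), integral_congr_ae h3]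
        rw [integral_eq_zero_of_ae]
        filter_upwards [hzero n (by omega)] with ω hω
        simp [hω]
      exact h4
    refine ⟨(h1.add hXn).ae_eq (.of_forall fun ω => (Finset.sum_range_succ _ _).symm), ?_⟩
    have hexp : ∀ ω, (∑ i ∈ Finset.range (n + 1), X i ω) ^ 2
        = S ω ^ 2 + 2 * (S ω * X n ω) + X n ω ^ 2 := fun ω => by
      rw [Finset.sum_range_succ]; ring
    simp_rw [hexp]
    have hi2 : Integrable (fun ω => 2 * (S ω * X n ω)) μ := hSX.const_mul 2
    have hi1 : Integrable (fun ω => S ω ^ 2 + 2 * (S ω * X n ω)) μ := h1.integrable_sq.add hi2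
    rw [integral_add hi1 hXn.integrable_sq,
      integral_add h1.integrable_sq hi2, integral_const_mul, hcross]
    push_cast
    linarith [hb n (by omega)]

end Moments

/-! ### Second moments of the errors along a random run. -/

section Run

open Metric Set
open scoped ENNReal

local notation "⟪" x ", " y "⟫" => inner ℝ x y

variable {Ω : Type*} {d : ℕ} {M : Matrix (Fin d) (Fin d) ℝ} {P : NPMParams}
  {A₀ : Ω → Vec d} {Z : ℕ → Ω → Fin P.batch → Vec d} {η : ℕ → Ω → ℝ}

/-- The iterates of a run as random vectors. -/
noncomputable def runIterate (M : Matrix (Fin d) (Fin d) ℝ) (P : NPMParams) (A₀ : Ω → Vec d)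
    (Z : ℕ → Ω → Fin P.batch → Vec d) (η : ℕ → Ω → ℝ) (l : ℕ) (ω : Ω) : Vec d :=
  npmIterate M P (A₀ ω) (fun l => Z l ω) (fun t => η t ω) l

theorem history_mono {n k k' t t' : ℕ} {Z : ℕ → Ω → Fin n → Vec d} (hk : k ≤ k') (ht : t ≤ t') :
    history A₀ Z η k t ≤ history A₀ Z η k' t' := by
  refine sup_le_sup (sup_le_sup le_rfl (iSup_le fun j => ?_)) (iSup_le fun s => ?_)
  · exact le_iSup (fun j : Fin k' => MeasurableSpace.comap (Z j) inferInstance)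
      ⟨j, j.2.trans_le hk⟩
  · exact le_iSup (fun j : Fin t' => MeasurableSpace.comap (η j) inferInstance)
      ⟨s, s.2.trans_le ht⟩

theorem measurable_init_history {n : ℕ} {Z : ℕ → Ω → Fin n → Vec d} (k t : ℕ) :
    Measurable[history A₀ Z η k t] A₀ :=
  measurable_iff_comap_le.2 (le_sup_left.trans le_sup_left)

theorem measurable_batch_history {n : ℕ} {Z : ℕ → Ω → Fin n → Vec d} {k j : ℕ} (hj : j < k)
    (t : ℕ) : Measurable[history A₀ Z η k t] (Z j) :=
  measurable_iff_comap_le.2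
    (((le_iSup (fun j : Fin k => MeasurableSpace.comap (Z j) inferInstance) ⟨j, hj⟩).trans
      le_sup_right).trans le_sup_left)

theorem measurable_noise_history {n : ℕ} {Z : ℕ → Ω → Fin n → Vec d} (k : ℕ) {s t : ℕ}
    (hs : s < t) : Measurable[history A₀ Z η k t] (η s) :=
  measurable_iff_comap_le.2
    ((le_iSup (fun j : Fin t => MeasurableSpace.comap (η j) inferInstance) ⟨s, hs⟩).trans
      le_sup_right)

theorem measurable_npmStep (M : Matrix (Fin d) (Fin d) ℝ) (n : ℕ) (m : ℝ) :
    Measurable fun p : Vec d × (Fin n → Vec d) × (Fin n → ℝ) =>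
      npmUpdate m p.2.1 fun i => quadReward M (exploreAction p.1 (p.2.1 i)) + p.2.2 i := by
  unfold npmUpdate exploreAction
  fun_prop

/-- This history is exactly the one that the batch `Z l` is independent of. -/
theorem measurable_runIterate (l : ℕ) :
    Measurable[history A₀ Z η l (l * P.batch)] (runIterate M P A₀ Z η l) := by
  induction l with
  | zero => exact measurable_init_history _ _
  | succ l ih =>
    have hmono : history A₀ Z η l (l * P.batch) ≤ history A₀ Z η (l + 1) ((l + 1) * P.batch) :=
      history_mono (by omega) (Nat.mul_le_mul_right _ (by omega))
    have h1 := ih.mono hmono le_rfl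
    have h2 : Measurable[history A₀ Z η (l + 1) ((l + 1) * P.batch)] (Z l) :=
      measurable_batch_history (Nat.lt_succ_self l) _
    have h3 : Measurable[history A₀ Z η (l + 1) ((l + 1) * P.batch)]
        (fun ω => fun i : Fin P.batch => η (l * P.batch + i) ω) := by
      refine @measurable_pi_lambda _ _ _ (_) _ _ fun i => measurable_noise_history _ ?_
      have := i.2
      rw [Nat.succ_mul]
      omega
    have h4 := (measurable_npmStep M P.batch P.prec).comp (h1.prodMk (h2.prodMk h3))
    exact h4

theorem norm_npmUpdate_le {n : ℕ} (m : ℝ) (z : Fin n → Vec d) (r : Fin n → ℝ) :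
    ‖npmUpdate m z r‖ ≤ 1 := by
  unfold npmUpdate
  rw [norm_smul, norm_inv, norm_norm]
  exact inv_mul_le_one

theorem norm_npmIterate_le {a₀ : Vec d} (ha : ‖a₀‖ ≤ 1) (z : ℕ → Fin P.batch → Vec d)
    (e : ℕ → ℝ) (l : ℕ) : ‖npmIterate M P a₀ z e l‖ ≤ 1 := by
  cases l with
  | zero => exact ha
  | succ l => exact norm_npmUpdate_le _ _ _

/-- The deviation of the estimator from its mean direction in iteration `l`. -/
noncomputable def runError (M : Matrix (Fin d) (Fin d) ℝ) (P : NPMParams) (A₀ : Ω → Vec d)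
    (Z : ℕ → Ω → Fin P.batch → Vec d) (η : ℕ → Ω → ℝ) (l : ℕ) (ω : Ω) : Vec d :=
  (P.prec / P.batch) • ∑ i, (quadReward M (exploreAction (runIterate M P A₀ Z η l ω) (Z l ω i))
    + η (l * P.batch + i) ω) • Z l ω i
  - (P.prec * ballVar d P.prec / 2) • Matrix.toEuclideanLin M (runIterate M P A₀ Z η l ω)

theorem runIterate_succ (l : ℕ) (ω : Ω) :
    runIterate M P A₀ Z η (l + 1) ω =
      ‖(P.prec * ballVar d P.prec / 2) • Matrix.toEuclideanLin M (runIterate M P A₀ Z η l ω)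
        + runError M P A₀ Z η l ω‖⁻¹ •
      ((P.prec * ballVar d P.prec / 2) • Matrix.toEuclideanLin M (runIterate M P A₀ Z η l ω)
        + runError M P A₀ Z η l ω) := by
  rw [runError, add_sub_cancel]
  rfl

variable [mΩ : MeasurableSpace Ω] {μ : Measure Ω}

theorem IsNPMRun.history_le (h : IsNPMRun μ P A₀ Z η) (k t : ℕ) : history A₀ Z η k t ≤ mΩ :=
  sup_le (sup_le h.measurable_init.comap_le (iSup_le fun j => (h.measurable_batch j).comap_le))
    (iSup_le fun s => (h.measurable_noise s).comap_le)

theorem IsNPMRun.ae_norm_init (h : IsNPMRun μ P A₀ Z η) : ∀ᵐ ω ∂μ, ‖A₀ ω‖ = 1 := by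
  have h1 := ae_norm_eq_one_uniformSphere d
  rw [← h.init_law] at h1
  exact ae_of_ae_map h.measurable_init.aemeasurable h1

theorem IsNPMRun.ae_norm_batch_le (h : IsNPMRun μ P A₀ Z η) :
    ∀ᵐ ω ∂μ, ∀ l < P.iters, ∀ i, ‖Z l ω i‖ ≤ 1 := by
  rw [ae_all_iff]
  intro l
  by_cases hl : l < P.iters
  · have h1 := ae_norm_le_batchLaw d P.batch P.prec
    rw [← h.batch_law l hl] at h1
    filter_upwards [ae_of_ae_map (h.measurable_batch l).aemeasurable h1] with ω hω _ using hω
  · exact .of_forall fun ω hl' => absurd hl' hl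

theorem IsNPMRun.ae_norm_etcAction_le (h : IsNPMRun μ P A₀ Z η) :
    ∀ᵐ ω ∂μ, ∀ t, ‖etcAction M P (A₀ ω) (fun l => Z l ω) (fun s => η s ω) t‖ ≤ 1 := by
  filter_upwards [h.ae_norm_init, h.ae_norm_batch_le] with ω h1 h2 t
  unfold etcAction
  split_ifs with ht
  · exact norm_exploreAction_le (norm_npmIterate_le h1.le _ _ _)
      (h2 _ (Nat.div_lt_of_lt_mul (by rwa [mul_comm])) _)
  · exact norm_npmIterate_le h1.le _ _ _

theorem IsNPMRun.measurable_runError (h : IsNPMRun μ P A₀ Z η) (l : ℕ) :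
    Measurable (runError M P A₀ Z η l) := by
  have hTm : Measurable (Matrix.toEuclideanLin M) :=
    (LinearMap.continuous_of_finiteDimensional _).measurable
  have ha : Measurable (runIterate M P A₀ Z η l) :=
    (measurable_runIterate l).mono (h.history_le _ _) le_rfl
  have hZ : ∀ i, Measurable (fun ω => Z l ω i) := fun i =>
    (measurable_pi_apply i).comp (h.measurable_batch l)
  have hη := h.measurable_noise
  unfold runError exploreAction
  fun_prop

/-- It turns the exponential moments at `s = ±1` into a bound for the conditional second moment of
the noise. -/
theorem sq_le_exp_add_exp_neg (x : ℝ) : x ^ 2 ≤ Real.exp x + Real.exp (-x) := by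
  have hy : ∀ y : ℝ, 0 ≤ y → y ^ 2 ≤ Real.exp y := fun y hy => by
    have h1 := Real.quadratic_le_exp_of_nonneg (by positivity : 0 ≤ y / 2)
    have h2 : y ≤ Real.exp (y / 2) := by nlinarith [sq_nonneg (y - 2)]
    calc y ^ 2 ≤ Real.exp (y / 2) ^ 2 := by gcongr
      _ = Real.exp y := by rw [← Real.exp_nat_mul]; congr 1; push_cast; ring
  rcases le_total 0 x with h | h
  · linarith [hy x h, Real.exp_pos (-x)]
  · have := hy (-x) (by linarith)
    rw [neg_sq] at this
    linarith [Real.exp_pos x]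

theorem IsNPMRun.memLp_noise (h : IsNPMRun μ P A₀ Z η) {t : ℕ} (ht : t < P.samples) :
    MemLp (η t) 2 μ := by
  rw [memLp_two_iff_integrable_sq (h.measurable_noise t).aestronglyMeasurable]
  have h1 := h.noise_exp_integrable t ht 1
  have h2 := h.noise_exp_integrable t ht (-1)
  refine (h1.add h2).mono' ((h.measurable_noise t).pow_const 2).aestronglyMeasurable
    (.of_forall fun ω => ?_)
  rw [Real.norm_eq_abs, abs_of_nonneg (sq_nonneg _)]
  simpa using sq_le_exp_add_exp_neg (η t ω)

theorem exp_half_le_two : Real.exp (1 / 2) ≤ 2 := by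
  have h1 : Real.exp (1 / 2) ^ 2 = Real.exp 1 := by rw [← Real.exp_nat_mul]; norm_num
  have h2 := Real.exp_one_lt_three
  nlinarith [Real.exp_pos (1 / 2)]

theorem sample_lt {l i : ℕ} (hl : l < P.iters) (hi : i < P.batch) :
    l * P.batch + i < P.samples ∧ (l * P.batch + i) / P.batch = l := by
  constructor
  · unfold NPMParams.samples
    nlinarith
  · rw [mul_comm, Nat.mul_add_div (by omega), Nat.div_eq_of_lt hi, add_zero]

theorem IsNPMRun.integral_inner_batch_sq (h : IsNPMRun μ P A₀ Z η)
    (hp : gaussianVec d P.prec (closedBall 0 1) ≠ 0) {l : ℕ} (hl : l < P.iters)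
    (i : Fin P.batch) {w : Vec d} (hw : ‖w‖ = 1) :
    ∫ ω, ⟪w, Z l ω i⟫ ^ 2 ∂μ = ballVar d P.prec := by
  have := isProbabilityMeasure_ballGaussian hp
  have hlaw : μ.map (fun ω => Z l ω i) = ballGaussian d P.prec := by
    have h1 : (fun ω => Z l ω i) = Function.eval i ∘ Z l := rfl
    rw [h1, ← Measure.map_map (measurable_pi_apply i) (h.measurable_batch l), h.batch_law l hl,
      batchLaw_eq_pi hp]
    exact (measurePreserving_eval (fun _ : Fin P.batch => ballGaussian d P.prec) i).map_eq
  have h2 := integral_inner_sq_ballGaussian P.prec w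
  rw [← hlaw, integral_map, hw, one_pow, mul_one] at h2
  · exact h2
  · exact ((measurable_pi_apply i).comp (h.measurable_batch l)).aemeasurable
  · exact Measurable.aestronglyMeasurable (by fun_prop)

variable [IsProbabilityMeasure μ]

/-- Conditionally on the past, the noise has second moment at most `4`. -/
theorem IsNPMRun.integral_noise_mul_sq_le (h : IsNPMRun μ P A₀ Z η) {t : ℕ} (ht : t < P.samples)
    {W : Ω → ℝ} (hW : StronglyMeasurable[history A₀ Z η (t / P.batch + 1) t] W)
    (hW1 : ∀ᵐ ω ∂μ, |W ω| ≤ 1) :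
    ∫ ω, (η t ω * W ω) ^ 2 ∂μ ≤ 4 * ∫ ω, W ω ^ 2 ∂μ := by
  have hle : history A₀ Z η (t / P.batch + 1) t ≤ mΩ := h.history_le _ _
  have hW2 : StronglyMeasurable[history A₀ Z η (t / P.batch + 1) t] (fun ω => W ω ^ 2) := hW.pow 2
  have hb : ∀ᵐ ω ∂μ, ‖W ω ^ 2‖ ≤ 1 := by
    filter_upwards [hW1] with ω hω
    rw [Real.norm_eq_abs, abs_of_nonneg (sq_nonneg _), ← sq_abs]
    exact pow_le_one₀ (abs_nonneg _) hω
  have hWint : Integrable (fun ω => W ω ^ 2) μ :=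
    Integrable.of_bound (hW2.mono hle).aestronglyMeasurable 1 hb
  -- `W²` is known before the reward, so it comes out of the conditional expectation, leaving `exp
  -- (1/2) ≤ 2` for each sign.
  have hexp : ∀ s : ℝ, s ^ 2 = 1 →
      Integrable (fun ω => W ω ^ 2 * Real.exp (s * η t ω)) μ ∧
      ∫ ω, W ω ^ 2 * Real.exp (s * η t ω) ∂μ ≤ 2 * ∫ ω, W ω ^ 2 ∂μ := by
    intro s hs
    have hi := h.noise_exp_integrable t ht s
    have hprod : Integrable (fun ω => W ω ^ 2 * Real.exp (s * η t ω)) μ :=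
      hi.bdd_mul (hW2.mono hle).aestronglyMeasurable hb
    refine ⟨hprod, ?_⟩
    have hce := condExp_mul_of_stronglyMeasurable_left (μ := μ) (m := history A₀ Z η (t / P.batch + 1) t) hW2 hprod hi
    have h0 : ∫ ω, W ω ^ 2 * Real.exp (s * η t ω) ∂μ
        = ∫ ω, W ω ^ 2 * (μ[fun ω => Real.exp (s * η t ω) | history A₀ Z η (t / P.batch + 1) t]) ω ∂μ := by
      have h1 := integral_condExp (μ := μ) hle
        (f := (fun ω => W ω ^ 2) * fun ω => Real.exp (s * η t ω))
      have h2 := integral_congr_ae hce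
      rw [h1] at h2
      exact h2
    rw [h0, ← integral_const_mul]
    refine integral_mono_ae ?_ (hWint.const_mul 2) ?_
    · exact integrable_condExp.bdd_mul (hW2.mono hle).aestronglyMeasurable hb
    · filter_upwards [h.noise_subGaussian t ht s] with ω hω
      rw [hs] at hω
      rw [mul_comm 2]
      exact mul_le_mul_of_nonneg_left (hω.trans exp_half_le_two) (sq_nonneg _)
  obtain ⟨h1, h2⟩ := hexp 1 (by norm_num)
  obtain ⟨h3, h4⟩ := hexp (-1) (by norm_num)
  calc ∫ ω, (η t ω * W ω) ^ 2 ∂μ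
      ≤ ∫ ω, (W ω ^ 2 * Real.exp (1 * η t ω) + W ω ^ 2 * Real.exp (-1 * η t ω)) ∂μ := by
        refine integral_mono_of_nonneg (.of_forall fun ω => sq_nonneg _) (h1.add h3)
          (.of_forall fun ω => ?_)
        have := mul_le_mul_of_nonneg_left (sq_le_exp_add_exp_neg (η t ω)) (sq_nonneg (W ω))
        simp only [one_mul, neg_mul, mul_pow]
        linarith
    _ ≤ _ := by rw [integral_add h1 h3]; linarith

/-- The reward-noise part of the estimator, in a fixed direction. -/
theorem IsNPMRun.lintegral_noise_sq_le (h : IsNPMRun μ P A₀ Z η)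
    (hp : gaussianVec d P.prec (closedBall 0 1) ≠ 0) {l : ℕ} (hl : l < P.iters)
    {w : Vec d} (hw : ‖w‖ = 1) :
    ∫⁻ ω, ENNReal.ofReal ((∑ i : Fin P.batch, η (l * P.batch + i) ω * ⟪w, Z l ω i⟫) ^ 2) ∂μ
      ≤ ENNReal.ofReal (4 * (P.batch * ballVar d P.prec)) := by
  -- The value 0 beyond the batch only serves to index the summands by `ℕ`.
  set W : ℕ → Ω → ℝ := fun i ω => if hi : i < P.batch then ⟪w, Z l ω ⟨i, hi⟩⟫ else 0 with hWdef
  have hWm : ∀ i t, StronglyMeasurable[history A₀ Z η (l + 1) t] (W i) := by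
    intro i t
    by_cases hi : i < P.batch
    · have h1 : Measurable[history A₀ Z η (l + 1) t] (fun ω => Z l ω ⟨i, hi⟩) :=
        (measurable_pi_apply _).comp (measurable_batch_history (Nat.lt_succ_self l) t)
      have h2 : Measurable fun z : Vec d => ⟪w, z⟫ := by fun_prop
      simp only [hWdef, hi, dif_pos]
      exact (h2.comp h1).stronglyMeasurable
    · simp only [hWdef, hi, dif_neg, not_false_eq_true]
      exact stronglyMeasurable_const
  have hW1 : ∀ i, ∀ᵐ ω ∂μ, |W i ω| ≤ 1 := fun i => by
    filter_upwards [h.ae_norm_batch_le] with ω hω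
    simp only [hWdef]
    split_ifs with hi
    · exact (abs_inner_le_of_norm_le_one w (hω l hl _)).trans hw.le
    · simp
  -- This contains the whole batch `l` and the noise before sample `i`: it determines all `W i` and
  -- the earlier summands, while the noise of sample `i` is still centred.
  set H : ℕ → MeasurableSpace Ω := fun i => history A₀ Z η (l + 1) (l * P.batch + i)
  have hX : ∀ i < P.batch, MemLp (fun ω => η (l * P.batch + i) ω * W i ω) 2 μ := fun i hi => by
    obtain ⟨ht, _⟩ := sample_lt hl hi
    have h1 := h.memLp_noise ht
    refine h1.mono (h1.1.mul ((hWm i 0).mono (h.history_le _ _)).aestronglyMeasurable) ?_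
    filter_upwards [hW1 i] with ω hω
    rw [norm_mul]
    exact mul_le_of_le_one_right (norm_nonneg _) hω
  obtain ⟨h1, h2⟩ := integral_sq_sum_le_of_condExp_eq_zero
    (X := fun i ω => η (l * P.batch + i) ω * W i ω) (H := H) (b := 4 * ballVar d P.prec)
    (fun i => h.history_le _ _) P.batch hX
    (by
      intro j _ i hij
      have h3 : Measurable[H j] (η (l * P.batch + i)) :=
        measurable_noise_history _ (by omega)
      exact h3.stronglyMeasurable.mul (hWm i _))
    (by
      intro i hi
      obtain ⟨ht, hdiv⟩ := sample_lt hl hi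
      have h3 := h.noise_mean _ ht
      rw [hdiv] at h3
      have h4 := condExp_mul_of_stronglyMeasurable_right (μ := μ) (m := H i) (hWm i _)
        ((hX i hi).integrable one_le_two) (h.noise_integrable _ ht)
      refine h4.trans ?_
      filter_upwards [h3] with ω hω
      rw [Pi.mul_apply, hω]
      simp)
    (by
      intro i hi
      obtain ⟨ht, hdiv⟩ := sample_lt hl hi
      have h3 := h.integral_noise_mul_sq_le ht (W := W i) (by rw [hdiv]; exact hWm i _) (hW1 i)
      have h4 : ∫ ω, W i ω ^ 2 ∂μ = ballVar d P.prec := by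
        simp only [hWdef, hi, dif_pos]
        exact h.integral_inner_batch_sq hp hl _ hw
      rwa [h4] at h3)
  rw [← ofReal_integral_eq_lintegral_ofReal _ (.of_forall fun _ => sq_nonneg _)]
  · apply ENNReal.ofReal_le_ofReal
    simp only [Finset.sum_range] at h2
    have h5 : ∀ ω, ∀ i : Fin P.batch, W i ω = ⟪w, Z l ω i⟫ := fun ω i => by simp [hWdef]
    simp only [h5] at h2
    linarith
  · have h6 := h1.integrable_sq
    simp only [Finset.sum_range] at h6
    have h5 : ∀ ω, ∀ i : Fin P.batch, W i ω = ⟪w, Z l ω i⟫ := fun ω i => by simp [hWdef]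
    simpa only [h5] using h6

/-- The mean-reward part of the estimator, in a fixed direction. -/
theorem IsNPMRun.lintegral_signal_sq_le (h : IsNPMRun μ P A₀ Z η)
    (hM : (Matrix.toEuclideanLin M).IsPositive) (hf : ∀ x, ‖x‖ ≤ 1 → |quadReward M x| ≤ 1)
    (hp : gaussianVec d P.prec (closedBall 0 1) ≠ 0) {l : ℕ} (hl : l < P.iters)
    {w : Vec d} (hw : ‖w‖ = 1) :
    ∫⁻ ω, ENNReal.ofReal ((∑ i : Fin P.batch,
        quadReward M (exploreAction (runIterate M P A₀ Z η l ω) (Z l ω i)) * ⟪w, Z l ω i⟫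
        - P.batch * (ballVar d P.prec / 2
          * ⟪w, Matrix.toEuclideanLin M (runIterate M P A₀ Z η l ω)⟫)) ^ 2) ∂μ
      ≤ ENNReal.ofReal (P.batch * ballVar d P.prec) := by
  set F : Vec d × (Fin P.batch → Vec d) → ℝ≥0∞ := fun p => ENNReal.ofReal ((∑ i : Fin P.batch,
        quadReward M (exploreAction p.1 (p.2 i)) * ⟪w, p.2 i⟫
        - P.batch * (ballVar d P.prec / 2 * ⟪w, Matrix.toEuclideanLin M p.1⟫)) ^ 2) with hF
  have hTm : Measurable (Matrix.toEuclideanLin M) :=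
    (LinearMap.continuous_of_finiteDimensional _).measurable
  have hFm : Measurable F := by
    unfold F exploreAction
    fun_prop
  have ha : Measurable (runIterate M P A₀ Z η l) :=
    (measurable_runIterate l).mono (h.history_le _ _) le_rfl
  -- Independence makes the joint law a product, so the bound for a frozen iterate can be integrated
  -- over the law of the iterate.
  have hind : IndepFun (runIterate M P A₀ Z η l) (Z l) μ := by
    rw [IndepFun_iff_Indep]
    exact (indep_of_indep_of_le_right (h.batch_indep l hl)
      (measurable_iff_comap_le.1 (measurable_runIterate l))).symm
  have hmap := (indepFun_iff_map_prod_eq_prod_map_map ha.aemeasurable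
    (h.measurable_batch l).aemeasurable).1 hind
  have hpm : IsProbabilityMeasure (μ.map (Z l)) :=
    Measure.isProbabilityMeasure_map (h.measurable_batch l).aemeasurable
  have hpa : IsProbabilityMeasure (μ.map (runIterate M P A₀ Z η l)) :=
    Measure.isProbabilityMeasure_map ha.aemeasurable
  have hnorm : ∀ᵐ a ∂(μ.map (runIterate M P A₀ Z η l)), ‖a‖ ≤ 1 := by
    rw [ae_map_iff ha.aemeasurable (measurableSet_le (by fun_prop) (by fun_prop))]
    filter_upwards [h.ae_norm_init] with ω hω using norm_npmIterate_le hω.le _ _ _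
  calc ∫⁻ ω, F (runIterate M P A₀ Z η l ω, Z l ω) ∂μ
      = ∫⁻ p, F p ∂((μ.map (runIterate M P A₀ Z η l)).prod (μ.map (Z l))) := by
        rw [← hmap, lintegral_map hFm (ha.prodMk (h.measurable_batch l))]
    _ = ∫⁻ a, ∫⁻ z, F (a, z) ∂(μ.map (Z l)) ∂(μ.map (runIterate M P A₀ Z η l)) :=
        lintegral_prod _ hFm.aemeasurable
    _ ≤ ∫⁻ _, ENNReal.ofReal (P.batch * ballVar d P.prec)
          ∂(μ.map (runIterate M P A₀ Z η l)) := by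
        refine lintegral_mono_ae ?_
        filter_upwards [hnorm] with a ha1
        rw [h.batch_law l hl]
        exact integral_signal_sq_le hM hf ha1 P.batch hp hw
    _ = _ := by simp

/-- Second moment of the error in a fixed direction. -/
theorem IsNPMRun.lintegral_inner_runError_sq_le (h : IsNPMRun μ P A₀ Z η)
    (hM : (Matrix.toEuclideanLin M).IsPositive) (hf : ∀ x, ‖x‖ ≤ 1 → |quadReward M x| ≤ 1)
    (hp : gaussianVec d P.prec (closedBall 0 1) ≠ 0) (hb : 0 < P.batch) (hm : 0 < P.prec)
    (hv : ballVar d P.prec ≤ 2 / P.prec) {l : ℕ} (hl : l < P.iters) {w : Vec d} (hw : ‖w‖ = 1) :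
    ∫⁻ ω, ENNReal.ofReal (⟪w, runError M P A₀ Z η l ω⟫ ^ 2) ∂μ
      ≤ ENNReal.ofReal (20 * P.prec / P.batch) := by
  have hb0 : (0 : ℝ) < P.batch := by exact_mod_cast hb
  set S : Ω → ℝ := fun ω => ∑ i : Fin P.batch,
        quadReward M (exploreAction (runIterate M P A₀ Z η l ω) (Z l ω i)) * ⟪w, Z l ω i⟫
        - P.batch * (ballVar d P.prec / 2
          * ⟪w, Matrix.toEuclideanLin M (runIterate M P A₀ Z η l ω)⟫) with hS
  set N : Ω → ℝ := fun ω => ∑ i : Fin P.batch, η (l * P.batch + i) ω * ⟪w, Z l ω i⟫ with hN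
  have hdec : ∀ ω, ⟪w, runError M P A₀ Z η l ω⟫ = P.prec / P.batch * (S ω + N ω) := by
    intro ω
    simp only [runError, hS, hN, inner_sub_right, real_inner_smul_right, inner_sum, add_mul,
      Finset.sum_add_distrib]
    field_simp
    ring
  have hSm : Measurable S := by
    have hTm : Measurable (Matrix.toEuclideanLin M) :=
      (LinearMap.continuous_of_finiteDimensional _).measurable
    have ha : Measurable (runIterate M P A₀ Z η l) :=
      (measurable_runIterate l).mono (h.history_le _ _) le_rfl
    have hZ : ∀ i, Measurable (fun ω => Z l ω i) := fun i =>
      (measurable_pi_apply i).comp (h.measurable_batch l)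
    unfold S exploreAction
    fun_prop
  -- From `(S + N)² ≤ 2 S² + 2 N²`. The two parts contribute `n σ²` and `4 n σ²` with `σ² ≤ 2/m`,
  -- which makes `20 m / n`.
  set k : ℝ := 2 * (P.prec / P.batch) ^ 2 with hk
  have hk0 : 0 ≤ k := by positivity
  have h1 := h.lintegral_signal_sq_le hM hf hp hl hw
  have h2 := h.lintegral_noise_sq_le hp hl hw
  calc ∫⁻ ω, ENNReal.ofReal (⟪w, runError M P A₀ Z η l ω⟫ ^ 2) ∂μ
      ≤ ∫⁻ ω, (ENNReal.ofReal k * ENNReal.ofReal (S ω ^ 2)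
          + ENNReal.ofReal k * ENNReal.ofReal (N ω ^ 2)) ∂μ := by
        refine lintegral_mono fun ω => ?_
        rw [← ENNReal.ofReal_mul hk0, ← ENNReal.ofReal_mul hk0,
          ← ENNReal.ofReal_add (by positivity) (by positivity), hdec]
        apply ENNReal.ofReal_le_ofReal
        rw [mul_pow, hk]
        nlinarith [mul_nonneg (sq_nonneg (P.prec / P.batch)) (sq_nonneg (S ω - N ω))]
    _ = ENNReal.ofReal k * ∫⁻ ω, ENNReal.ofReal (S ω ^ 2) ∂μ
          + ENNReal.ofReal k * ∫⁻ ω, ENNReal.ofReal (N ω ^ 2) ∂μ := by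
        rw [lintegral_add_left (by fun_prop), lintegral_const_mul' _ _ ENNReal.ofReal_ne_top,
          lintegral_const_mul' _ _ ENNReal.ofReal_ne_top]
    _ ≤ ENNReal.ofReal k * ENNReal.ofReal (P.batch * ballVar d P.prec)
          + ENNReal.ofReal k * ENNReal.ofReal (4 * (P.batch * ballVar d P.prec)) := by
        gcongr
    _ ≤ _ := by
        have hv0 : 0 ≤ ballVar d P.prec :=
          div_nonneg (integral_nonneg fun z => by positivity) (by positivity)
        rw [← ENNReal.ofReal_mul hk0, ← ENNReal.ofReal_mul hk0,
          ← ENNReal.ofReal_add (by positivity) (by positivity)]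
        apply ENNReal.ofReal_le_ofReal
        calc k * (P.batch * ballVar d P.prec) + k * (4 * (P.batch * ballVar d P.prec))
            = 10 * P.prec ^ 2 / P.batch * ballVar d P.prec := by
              rw [hk]; field_simp; ring
          _ ≤ 10 * P.prec ^ 2 / P.batch * (2 / P.prec) := by gcongr
          _ = _ := by field_simp; ring

/-- Second moment of the norm of the error. -/
theorem IsNPMRun.lintegral_norm_runError_sq_le (h : IsNPMRun μ P A₀ Z η)
    (hM : (Matrix.toEuclideanLin M).IsPositive) (hf : ∀ x, ‖x‖ ≤ 1 → |quadReward M x| ≤ 1)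
    (hp : gaussianVec d P.prec (closedBall 0 1) ≠ 0) (hb : 0 < P.batch) (hm : 0 < P.prec)
    (hv : ballVar d P.prec ≤ 2 / P.prec) {l : ℕ} (hl : l < P.iters) :
    ∫⁻ ω, ENNReal.ofReal (‖runError M P A₀ Z η l ω‖ ^ 2) ∂μ
      ≤ ENNReal.ofReal (d * (20 * P.prec / P.batch)) := by
  set b := EuclideanSpace.basisFun (Fin d) ℝ
  have hm := h.measurable_runError (M := M) l
  have hsum : ∀ x : Vec d, ENNReal.ofReal (‖x‖ ^ 2) = ∑ i, ENNReal.ofReal (⟪b i, x⟫ ^ 2) := by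
    intro x
    rw [← ENNReal.ofReal_sum_of_nonneg fun _ _ => sq_nonneg _, ← b.sum_sq_norm_inner_right x]
    simp
  simp_rw [hsum]
  rw [lintegral_finsetSum _ fun i _ => by fun_prop]
  calc _ ≤ ∑ i : Fin d, ENNReal.ofReal (20 * P.prec / P.batch) :=
        Finset.sum_le_sum fun i _ =>
          h.lintegral_inner_runError_sq_le hM hf hp hb (by assumption) hv hl (b.norm_eq_one i)
    _ = _ := by
        rw [Finset.sum_const, ENNReal.ofReal_mul (by positivity), Finset.card_univ,
          Fintype.card_fin, nsmul_eq_mul]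
        simp

end Run

/-! ### Success probability of a run with large enough inputs. -/

section Success

open Metric Set
open scoped ENNReal

local notation "⟪" x ", " y "⟫" => inner ℝ x y

section Spectral

variable {d : ℕ} {M : Matrix (Fin d) (Fin d) ℝ} {lam : ℝ}

theorem quadReward_le_of_isGreatest_spectrum (hM : M.PosSemidef)
    (hlam : IsGreatest (spectrum ℝ M) lam) (a : Vec d) : quadReward M a ≤ lam * ‖a‖ ^ 2 := by
  have hH := hM.isHermitian
  set b := hH.eigenvectorBasis
  have hb : ∀ i, Matrix.toEuclideanLin M (b i) = hH.eigenvalues i • b i := fun i => by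
    ext j
    have := congrFun (hH.mulVec_eigenvectorBasis i) j
    simpa using this
  have hT := (Matrix.isPositive_toEuclideanLin_iff.2 hM).isSymmetric
  rw [quadReward_eq_inner, ← b.sum_inner_mul_inner a, ← b.sum_sq_norm_inner_right a, Finset.mul_sum]
  refine Finset.sum_le_sum fun i _ => ?_
  have hle : hH.eigenvalues i ≤ lam := hlam.2 (by
    rw [hH.spectrum_real_eq_range_eigenvalues]; exact mem_range_self i)
  rw [← hT (b i) a, hb, real_inner_smul_left, real_inner_comm a, Real.norm_eq_abs, sq_abs]
  nlinarith [sq_nonneg ⟪b i, a⟫]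

theorem exists_unit_eigenvector (hM : M.PosSemidef) (hlam : lam ∈ spectrum ℝ M) :
    ∃ v : Vec d, ‖v‖ = 1 ∧ Matrix.toEuclideanLin M v = lam • v := by
  have hH := hM.isHermitian
  rw [hH.spectrum_real_eq_range_eigenvalues] at hlam
  obtain ⟨i, rfl⟩ := hlam
  refine ⟨hH.eigenvectorBasis i, hH.eigenvectorBasis.norm_eq_one i, ?_⟩
  ext j
  have := congrFun (hH.mulVec_eigenvectorBasis i) j
  simpa using this

theorem quadReward_nonneg (hM : M.PosSemidef) (a : Vec d) : 0 ≤ quadReward M a := by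
  rw [quadReward_eq_inner]
  exact (Matrix.isPositive_toEuclideanLin_iff.2 hM).inner_nonneg_right a

theorem bestReward_le (hM : M.PosSemidef) (hlam : IsGreatest (spectrum ℝ M) lam)
    (h0 : 0 ≤ lam) : bestReward M ≤ lam := by
  have : Nonempty (closedBall (0 : Vec d) 1) := ⟨⟨0, by simp⟩⟩
  refine ciSup_le fun a => ?_
  have h1 : ‖(a : Vec d)‖ ≤ 1 := mem_closedBall_zero_iff.1 a.2
  refine (quadReward_le_of_isGreatest_spectrum hM hlam a).trans ?_
  exact mul_le_of_le_one_right h0 (pow_le_one₀ (norm_nonneg _) h1)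

end Spectral

theorem measureReal_le_of_lintegral_sum_le {Ω : Type*} [MeasurableSpace Ω] {μ : Measure Ω}
    {L : ℕ} {f : ℕ → Ω → ℝ} (hf : ∀ l, Measurable (f l)) (h0 : ∀ l ω, 0 ≤ f l ω) {b θ p : ℝ}
    (hb0 : 0 ≤ b) (hb : ∀ l < L, ∫⁻ ω, ENNReal.ofReal (f l ω) ∂μ ≤ ENNReal.ofReal b) (hθ : 0 < θ)
    (hp : L * b ≤ p * θ) :
    μ.real {ω | θ < ∑ l ∈ Finset.range L, f l ω} ≤ p := by
  have hsum : ∫⁻ ω, ENNReal.ofReal (∑ l ∈ Finset.range L, f l ω) ∂μ ≤ ENNReal.ofReal (L * b) := by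
    simp_rw [ENNReal.ofReal_sum_of_nonneg fun l _ => h0 l _]
    rw [lintegral_finsetSum _ fun l _ => (hf l).ennreal_ofReal]
    refine (Finset.sum_le_sum fun l hl => hb l (Finset.mem_range.1 hl)).trans ?_
    rw [Finset.sum_const, Finset.card_range, nsmul_eq_mul, ENNReal.ofReal_mul (by positivity)]
    simp
  have hmk := mul_meas_ge_le_lintegral (μ := μ)
    (f := fun ω => ENNReal.ofReal (∑ l ∈ Finset.range L, f l ω))
    (Finset.measurable_fun_sum _ fun l _ => hf l).ennreal_ofReal (ENNReal.ofReal θ)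
  have hp0 : 0 ≤ p := by
    have : 0 ≤ (L : ℝ) * b := by positivity
    by_contra! hneg
    nlinarith
  have hsub : μ {ω | θ < ∑ l ∈ Finset.range L, f l ω}
      ≤ μ {ω | ENNReal.ofReal θ ≤ ENNReal.ofReal (∑ l ∈ Finset.range L, f l ω)} :=
    measure_mono fun ω hω => ENNReal.ofReal_le_ofReal (le_of_lt hω)
  have h1 : ENNReal.ofReal θ * μ {ω | θ < ∑ l ∈ Finset.range L, f l ω}
      ≤ ENNReal.ofReal θ * ENNReal.ofReal p := by
    rw [← ENNReal.ofReal_mul hθ.le, mul_comm θ]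
    exact (mul_le_mul_right hsub _).trans
      (hmk.trans (hsum.trans (ENNReal.ofReal_le_ofReal hp)))
  have h2 := (ENNReal.mul_le_mul_iff_right (by simpa using hθ) ENNReal.ofReal_ne_top).1 h1
  exact ENNReal.toReal_le_of_le_ofReal hp0 h2

variable {Ω : Type*}
  {d : ℕ} {M : Matrix (Fin d) (Fin d) ℝ} {P : NPMParams} {lam e : ℝ}
  {A₀ : Ω → Vec d} {Z : ℕ → Ω → Fin P.batch → Vec d} {η : ℕ → Ω → ℝ}

/-- Cauchy-Schwarz. The factor `L` lost here is one of the two in the requirement on `n`. -/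
theorem sum_le_of_sum_sq_le {L : ℕ} (hL : 0 < L) {f : ℕ → ℝ} {b : ℝ} (hb : 0 ≤ b)
    (h : ∑ l ∈ Finset.range L, f l ^ 2 ≤ b ^ 2 / L) : ∑ l ∈ Finset.range L, f l ≤ b := by
  have h1 := sq_sum_le_card_mul_sum_sq (s := Finset.range L) (f := f)
  rw [Finset.card_range] at h1
  rw [le_div_iff₀ (by positivity)] at h
  exact abs_le_of_sq_le_sq' (by linarith) hb |>.2

/-- The deterministic part of the success event of a run. -/
theorem quadReward_runIterate_ge (hM : M.PosSemidef) (hlam : IsGreatest (spectrum ℝ M) lam)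
    (h0 : 0 < lam) (hd : 1 ≤ d) (he0 : 0 < e) (he : e ≤ 1 / 2)
    (hv : 1 / 4 ≤ P.prec * ballVar d P.prec / 2)
    {L : ℕ} (hLpos : 0 < L) (hL : 1 + Real.log (640 * √d) < L * (e ^ 2 / 8))
    {v : Vec d} (hv1 : ‖v‖ = 1) (hTv : Matrix.toEuclideanLin M v = lam • v) {ω : Ω}
    (hA0 : ‖A₀ ω‖ = 1) (hu : 1 / (160 * √d) ≤ |⟪v, A₀ ω⟫|)
    (hX : ∑ l ∈ Finset.range L, ‖runError M P A₀ Z η l ω‖ ^ 2 ≤ (e * lam / 24) ^ 2 / L)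
    (hXv : ∑ l ∈ Finset.range L, ⟪v, runError M P A₀ Z η l ω⟫ ^ 2
      ≤ (lam / (2560 * √d)) ^ 2 / L) :
    lam - quadReward M (runIterate M P A₀ Z η L ω) ≤ lam * e ^ 2 := by
  have hd0 : (1 : ℝ) ≤ √d := Real.one_le_sqrt.2 (by exact_mod_cast hd)
  have hT := Matrix.isPositive_toEuclideanLin_iff.2 hM
  set T := Matrix.toEuclideanLin M
  set A : Vec d →ₗ[ℝ] Vec d := lam⁻¹ • T with hAdef
  have hA : A.IsPositive := hT.smul_of_nonneg (by positivity)
  have hA1 : (LinearMap.id - A).IsPositive := by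
    rw [LinearMap.isPositive_iff]
    refine ⟨LinearMap.IsSymmetric.id.sub hA.isSymmetric, fun x => ?_⟩
    have := quadReward_le_of_isGreatest_spectrum hM hlam x
    rw [quadReward_eq_inner] at this
    simp only [LinearMap.sub_apply, LinearMap.id_apply, hAdef, LinearMap.smul_apply,
      inner_sub_left, real_inner_smul_left, real_inner_self_eq_norm_sq]
    rw [real_inner_comm, sub_nonneg, inv_mul_le_iff₀ h0]
    exact this
  have hAv : A v = v := by
    simp [hAdef, T, hTv, smul_smul, inv_mul_cancel₀ h0.ne']
  -- Normalisation ignores positive factors, so dividing the estimator by `s` leaves `A a` plus an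
  -- error enlarged by at most `4 / lam`.
  set s : ℝ := P.prec * ballVar d P.prec / 2 * lam with hs
  have hs0 : lam / 4 ≤ s := by nlinarith
  have hspos : 0 < s := by linarith
  have hstep : ∀ l < L, runIterate M P A₀ Z η (l + 1) ω
      = ‖A (runIterate M P A₀ Z η l ω) + s⁻¹ • runError M P A₀ Z η l ω‖⁻¹ •
        (A (runIterate M P A₀ Z η l ω) + s⁻¹ • runError M P A₀ Z η l ω) := by
    intro l _
    rw [runIterate_succ]
    have h1 : (P.prec * ballVar d P.prec / 2) • T (runIterate M P A₀ Z η l ω)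
        + runError M P A₀ Z η l ω
        = s • (A (runIterate M P A₀ Z η l ω) + s⁻¹ • runError M P A₀ Z η l ω) := by
      rw [smul_add, smul_smul, mul_inv_cancel₀ hspos.ne', one_smul, hAdef, LinearMap.smul_apply,
        smul_smul, hs, mul_assoc, mul_inv_cancel₀ h0.ne', mul_one]
    rw [h1, norm_smul, smul_smul, Real.norm_eq_abs, abs_of_pos hspos, mul_inv, mul_right_comm,
      inv_mul_cancel₀ hspos.ne', one_mul]
  have hu0 : 0 < |⟪v, A₀ ω⟫| := lt_of_lt_of_le (by positivity) hu
  have hsinv : s⁻¹ ≤ 4 / lam := by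
    rw [← inv_div]
    exact inv_anti₀ (by positivity) hs0
  have hg := sum_le_of_sum_sq_le hLpos (by positivity) hX
  have hgv := sum_le_of_sum_sq_le (f := fun l => |⟪v, runError M P A₀ Z η l ω⟫|) hLpos
    (by positivity : 0 ≤ lam / (2560 * √d)) (by simpa only [sq_abs] using hXv)
  have key := perturbed_power_method hA hA1 hv1 hAv (a := fun l => runIterate M P A₀ Z η l ω)
    (g := fun l => s⁻¹ • runError M P A₀ Z η l ω) he hA0 hstep hu0
    (by
      simp only [norm_smul, Real.norm_eq_abs, abs_of_pos (inv_pos.2 hspos)]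
      rw [← Finset.mul_sum]
      calc _ ≤ 4 / lam * (e * lam / 24) :=
            mul_le_mul hsinv hg (Finset.sum_nonneg fun _ _ => norm_nonneg _) (by positivity)
        _ = e / 6 := by field_simp; norm_num)
    (by
      simp only [real_inner_smul_right, abs_mul, abs_of_pos (inv_pos.2 hspos)]
      rw [← Finset.mul_sum]
      calc _ ≤ 4 / lam * (lam / (2560 * √d)) :=
            mul_le_mul hsinv hgv (Finset.sum_nonneg fun _ _ => abs_nonneg _) (by positivity)
        _ = 1 / (160 * √d) / 4 := by field_simp; norm_num
        _ ≤ _ := by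
          change _ ≤ |⟪v, A₀ ω⟫| / 4
          gcongr)
    (by
      refine lt_of_le_of_lt ?_ hL
      gcongr
      change 4 / |⟪v, A₀ ω⟫| ≤ _
      rw [div_le_iff₀ hu0]
      calc (4 : ℝ) = 640 * √d * (1 / (160 * √d)) := by field_simp; norm_num
        _ ≤ _ := by gcongr)
  rw [quadReward_eq_inner]
  simp only [hAdef, LinearMap.smul_apply, real_inner_smul_right] at key
  have h2 := mul_le_mul_of_nonneg_left key h0.le
  rw [mul_sub, mul_one, ← mul_assoc, mul_inv_cancel₀ h0.ne', one_mul] at h2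
  exact h2

variable [mΩ : MeasurableSpace Ω] {μ : Measure Ω} [IsProbabilityMeasure μ]

/-- A run succeeds with probability at least `9 / 10` if its inputs are large enough. -/
theorem IsNPMRun.prob_success (h : IsNPMRun μ P A₀ Z η) (hM : M.PosSemidef)
    (hlam : IsGreatest (spectrum ℝ M) lam) (h0 : 0 < lam) (h1 : lam ≤ 1) (hd : 1 ≤ d)
    (he0 : 0 < e) (he : e ≤ 1 / 2) (hm : 0 < P.prec) (hb : 0 < P.batch)
    (hp : 1 / 2 ≤ (gaussianVec d P.prec).real (closedBall 0 1))
    (ht : 16 * (√2 ^ d * Real.exp (-(P.prec / 8))) ≤ 1)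
    (hLpos : 0 < P.iters) (hL : 1 + Real.log (640 * √d) < P.iters * (e ^ 2 / 8))
    (hn : 6000000000 * P.iters ^ 2 * (P.prec * d) ≤ P.batch * (lam ^ 2 * e ^ 2)) :
    9 / 10 ≤ μ.real {ω | bestReward M
      - quadReward M (npmOutput M P (A₀ ω) (fun l => Z l ω) (fun t => η t ω)) ≤ lam * e ^ 2} := by
  have hb0 : (0 : ℝ) < P.batch := by exact_mod_cast hb
  have hL0 : (0 : ℝ) < P.iters := by exact_mod_cast hLpos
  have hd0 : (1 : ℝ) ≤ d := by exact_mod_cast hd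
  have hT := Matrix.isPositive_toEuclideanLin_iff.2 hM
  have hf : ∀ x : Vec d, ‖x‖ ≤ 1 → |quadReward M x| ≤ 1 := fun x hx => by
    rw [abs_of_nonneg (quadReward_nonneg hM x)]
    have h2 := quadReward_le_of_isGreatest_spectrum hM hlam x
    have h3 : ‖x‖ ^ 2 ≤ 1 := pow_le_one₀ (norm_nonneg _) hx
    nlinarith [sq_nonneg ‖x‖]
  have hp0 : gaussianVec d P.prec (closedBall 0 1) ≠ 0 := fun h2 => by
    rw [Measure.real, h2] at hp
    norm_num at hp
  have hvu := ballVar_le hd hm hp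
  have hvl : 1 / 4 ≤ P.prec * ballVar d P.prec / 2 := by
    have h2 := mul_le_mul_of_nonneg_left (le_ballVar hd hm hp ht) hm.le
    have h3 : P.prec * (1 / (2 * P.prec)) = 1 / 2 := by field_simp
    linarith
  obtain ⟨v, hv1, hTv⟩ := exists_unit_eigenvector hM hlam.1
  have hXm := h.measurable_runError (M := M)
  -- The three ways to fail: small initial overlap (probability `1/20`), large total error (`1/40`),
  -- large total error along `v` (`1/40`).
  set B0 : Set Ω := {ω | |⟪v, A₀ ω⟫| < 1 / (160 * √d)} with hB0
  set B1 : Set Ω := {ω | (e * lam / 24) ^ 2 / P.iters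
    < ∑ l ∈ Finset.range P.iters, ‖runError M P A₀ Z η l ω‖ ^ 2} with hB1
  set B2 : Set Ω := {ω | (lam / (2560 * √d)) ^ 2 / P.iters
    < ∑ l ∈ Finset.range P.iters, ⟪v, runError M P A₀ Z η l ω⟫ ^ 2} with hB2
  have hsqd : √d ^ 2 = (d : ℝ) := Real.sq_sqrt (by positivity)
  have hsqd0 : 0 < √(d : ℝ) := Real.sqrt_pos.2 (by linarith)
  have hp0' : μ.real B0 ≤ 1 / 20 := by
    -- `N = 40` makes the bound `2/40`, and `16 · 40² = 160²` then dictates the threshold.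
    have h2 := uniformSphere_abs_inner_lt_le (N := 40) hd (by norm_num) hv1
      (s := 1 / (160 * √d)) (by positivity) (by
        push_cast
        rw [div_pow, mul_pow, hsqd]
        field_simp
        norm_num)
    rw [← h.init_law, map_measureReal_apply h.measurable_init
      (measurableSet_lt (by fun_prop) measurable_const)] at h2
    refine h2.trans ?_
    norm_num
  have hp1 : μ.real B1 ≤ 1 / 40 := by
    refine measureReal_le_of_lintegral_sum_le
      (f := fun l ω => ‖runError M P A₀ Z η l ω‖ ^ 2)
      (fun l => (hXm l).norm.pow_const 2) (fun _ _ => by positivity)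
      (b := d * (20 * P.prec / P.batch)) (by positivity)
      (fun l hl => h.lintegral_norm_runError_sq_le hT hf hp0 hb hm hvu hl) (by positivity) ?_
    have : P.iters * (d * (20 * P.prec / P.batch)) = 20 * (P.iters ^ 2 * (P.prec * d))
        / (P.batch * P.iters) := by field_simp
    rw [this, div_le_iff₀ (by positivity)]
    have : 1 / 40 * ((e * lam / 24) ^ 2 / P.iters) * (P.batch * P.iters)
        = P.batch * (lam ^ 2 * e ^ 2) / 23040 := by field_simp; norm_num
    rw [this]
    have : 0 ≤ P.iters ^ 2 * (P.prec * d) := by positivity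
    linarith
  have hp2 : μ.real B2 ≤ 1 / 40 := by
    refine measureReal_le_of_lintegral_sum_le
      (f := fun l ω => ⟪v, runError M P A₀ Z η l ω⟫ ^ 2)
      (fun l => by have := hXm l; fun_prop) (fun _ _ => by positivity)
      (b := 20 * P.prec / P.batch) (by positivity)
      (fun l hl => h.lintegral_inner_runError_sq_le hT hf hp0 hb hm hvu hl hv1)
      (by positivity) ?_
    have : P.iters * (20 * P.prec / P.batch) = 20 * (P.iters ^ 2 * (P.prec * d))
        / (P.batch * P.iters * d) := by field_simp
    rw [this, div_le_iff₀ (by positivity), div_pow, mul_pow, hsqd]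
    -- The tolerance along `v` is smaller by `1/√d`, but so is the root mean square error. Since `40
    -- · 2560² = 262144000` and `20 · 262144000 < 6 · 10⁹`, this event decides the constant in `hn`.
    have : 1 / 40 * (lam ^ 2 / (2560 ^ 2 * d) / P.iters) * (P.batch * P.iters * d)
        = P.batch * lam ^ 2 / 262144000 := by field_simp; norm_num
    rw [this]
    have h2 : P.batch * (lam ^ 2 * e ^ 2) ≤ P.batch * lam ^ 2 * 1 := by
      rw [← mul_assoc]
      gcongr
      nlinarith
    have h3 : 0 ≤ P.iters ^ 2 * (P.prec * d) := by positivity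
    linarith
  have hm0 : MeasurableSet {ω | bestReward M
      - quadReward M (npmOutput M P (A₀ ω) (fun l => Z l ω) (fun t => η t ω)) ≤ lam * e ^ 2} := by
    have h2 : Measurable (runIterate M P A₀ Z η P.iters) :=
      (measurable_runIterate _).mono (h.history_le _ _) le_rfl
    exact measurableSet_le (measurable_const.sub ((measurable_quadReward M).comp h2))
      measurable_const
  have hcompl : μ.real {ω | bestReward M
      - quadReward M (npmOutput M P (A₀ ω) (fun l => Z l ω) (fun t => η t ω)) ≤ lam * e ^ 2}ᶜ
      ≤ μ.real (B0 ∪ (B1 ∪ B2)) := by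
    refine ENNReal.toReal_mono (measure_ne_top _ _) (measure_mono_ae ?_)
    filter_upwards [h.ae_norm_init] with ω hω hbad
    by_contra hgood
    have hgood' : ω ∉ B0 ∪ (B1 ∪ B2) := hgood
    simp only [mem_union, not_or, hB0, hB1, hB2, mem_ofPred_eq, not_lt] at hgood'
    have h2 := quadReward_runIterate_ge hM hlam h0 hd he0 he hvl hLpos hL hv1 hTv hω hgood'.1
      hgood'.2.1 hgood'.2.2
    exact hbad ((sub_le_sub_right (bestReward_le hM hlam h0.le) _).trans h2)
  have hu := measureReal_union_le (μ := μ) B0 (B1 ∪ B2)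
  have hu' := measureReal_union_le (μ := μ) B1 B2
  rw [measureReal_compl hm0, probReal_univ] at hcompl
  linarith

end Success

/-! ### The prescribed inputs meet the requirements. -/

section Parameters

variable {CL Cm Cn e lam : ℝ} {d : ℕ}

theorem half_le_log_div (hd : 1 ≤ d) (he0 : 0 < e) (he : e ≤ 1 / 2) :
    0.69 ≤ Real.log (d / e) := by
  have hd0 : (1 : ℝ) ≤ d := by exact_mod_cast hd
  have h1 : (2 : ℝ) ≤ d / e := by
    rw [le_div_iff₀ he0]; linarith
  have h2 := Real.log_le_log (by norm_num) h1
  have := Real.log_two_gt_d9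
  linarith

theorem npmIters_bounds (hCL : 64 ≤ CL) (hd : 1 ≤ d) (he0 : 0 < e) (he : e ≤ 1 / 2) :
    2 * CL * Real.log (d / e) / e ^ 2 ≤ npmIters CL d (1 - e ^ 2 / 2) e ∧
      (npmIters CL d (1 - e ^ 2 / 2) e : ℝ) ≤ (2 * CL + 1) * Real.log (d / e) / e ^ 2 := by
  have hl := half_le_log_div hd he0 he
  have h1 : CL * Real.log (d / e) / (1 - (1 - e ^ 2 / 2))
      = 2 * CL * Real.log (d / e) / e ^ 2 := by
    rw [sub_sub_cancel]; field_simp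
  unfold npmIters
  rw [h1]
  push_cast
  constructor
  · exact (Nat.lt_floor_add_one _).le
  · have h2 := Nat.floor_le (a := 2 * CL * Real.log (d / e) / e ^ 2)
      (div_nonneg (mul_nonneg (by linarith) (by linarith)) (by positivity))
    have h3 : 1 ≤ Real.log (d / e) / e ^ 2 := by
      rw [le_div_iff₀ (by positivity)]; nlinarith
    have h4 : (2 * CL + 1) * Real.log (d / e) / e ^ 2
        = 2 * CL * Real.log (d / e) / e ^ 2 + Real.log (d / e) / e ^ 2 := by ring
    linarith

/-- The logarithm in the batch size. -/
noncomputable def batchLog (L d : ℕ) (lam e : ℝ) : ℝ := Real.log (20 * L * d / (lam * e ^ 3))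

/-- All logarithms that occur are measured against this one. -/
theorem batchLog_bounds {L : ℕ} (hL : 1 ≤ L) (hd : 1 ≤ d) (h0 : 0 < lam) (h1 : lam ≤ 1)
    (he0 : 0 < e) (he : e ≤ 1 / 2) :
    1 ≤ batchLog L d lam e ∧ Real.log (d / e) ≤ batchLog L d lam e ∧
      Real.log (10 * L) ≤ batchLog L d lam e ∧
      Real.log (d / (lam * e ^ 3)) ≤ batchLog L d lam e := by
  have hd0 : (1 : ℝ) ≤ d := by exact_mod_cast hd
  have hL0 : (1 : ℝ) ≤ L := by exact_mod_cast hL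
  have hle : lam * e ^ 3 ≤ e := by
    have h2 : e ^ 3 ≤ e := pow_le_of_le_one he0.le (by linarith) (by norm_num)
    have h3 : lam * e ^ 3 ≤ 1 * e ^ 3 := by gcongr
    linarith
  have hpos : 0 < lam * e ^ 3 := by positivity
  have hmono : ∀ x, 0 < x → x * (lam * e ^ 3) ≤ 20 * L * d → Real.log x ≤ batchLog L d lam e :=
    fun x hx h => Real.log_le_log hx ((le_div_iff₀ hpos).2 h)
  have hLd : (1 : ℝ) ≤ L * d := one_le_mul_of_one_le_of_one_le hL0 hd0
  refine ⟨?_, ?_, ?_, ?_⟩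
  · rw [← Real.log_exp 1]
    refine hmono _ (Real.exp_pos _) ?_
    have := Real.exp_one_lt_three
    nlinarith
  · refine hmono _ (by positivity) ?_
    have h4 : (d : ℝ) / e * (lam * e ^ 3) ≤ d / e * e := by gcongr
    rw [div_mul_cancel₀ _ he0.ne'] at h4
    nlinarith
  · refine hmono _ (by positivity) ?_
    nlinarith
  · refine hmono _ (by positivity) ?_
    rw [div_mul_cancel₀ _ hpos.ne']
    nlinarith

theorem npmBatch_bounds (hCn : 1 ≤ Cn) {L : ℕ} (hL : 1 ≤ L) (hd : 1 ≤ d) (h0 : 0 < lam)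
    (h1 : lam ≤ 1) (he0 : 0 < e) (he : e ≤ 1 / 2) :
    4 * Cn * d ^ 2 * batchLog L d lam e ^ 3 / (lam ^ 2 * e ^ 6)
        ≤ npmBatch Cn 3 d lam (1 - e ^ 2 / 2) e (1 / (10 * L)) ∧
      (npmBatch Cn 3 d lam (1 - e ^ 2 / 2) e (1 / (10 * L)) : ℝ)
        ≤ 8 * Cn * d ^ 2 * batchLog L d lam e ^ 3 / (lam ^ 2 * e ^ 6) := by
  have hd0 : (1 : ℝ) ≤ d := by exact_mod_cast hd
  have hL0 : (1 : ℝ) ≤ L := by exact_mod_cast hL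
  obtain ⟨hb, -⟩ := batchLog_bounds hL hd h0 h1 he0 he
  have harg : Cn * (d : ℝ) ^ 2 * Real.log (d / (1 / (10 * L) * (lam * (1 - (1 - e ^ 2 / 2))) * e))
      ^ 3 / ((lam * (1 - (1 - e ^ 2 / 2))) ^ 2 * e ^ 2)
      = 4 * Cn * d ^ 2 * batchLog L d lam e ^ 3 / (lam ^ 2 * e ^ 6) := by
    -- Here `1/δ = 10 L` and `g = lam e² / 2`, whence the 20.
    have h2 : (d : ℝ) / (1 / (10 * L) * (lam * (1 - (1 - e ^ 2 / 2))) * e)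
        = 20 * L * d / (lam * e ^ 3) := by
      rw [sub_sub_cancel]; field_simp; norm_num
    rw [h2, batchLog, sub_sub_cancel]
    field_simp
    norm_num
  unfold npmBatch
  rw [harg]
  refine ⟨Nat.le_ceil _, ?_⟩
  have h3 : 1 ≤ 4 * Cn * d ^ 2 * batchLog L d lam e ^ 3 / (lam ^ 2 * e ^ 6) := by
    rw [one_le_div (by positivity)]
    have h4 : lam ^ 2 * e ^ 6 ≤ 1 * 1 := by
      gcongr
      · exact pow_le_one₀ h0.le h1
      · exact pow_le_one₀ he0.le (by linarith)
    have h5 : (1 : ℝ) ≤ d ^ 2 := one_le_pow₀ hd0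
    have h6 : 1 ≤ batchLog L d lam e ^ 3 := one_le_pow₀ hb
    have h7 : 1 ≤ Cn * d ^ 2 * batchLog L d lam e ^ 3 :=
      one_le_mul_of_one_le_of_one_le (one_le_mul_of_one_le_of_one_le hCn h5) h6
    linarith
  have h8 := (Nat.ceil_lt_add_one (zero_le_one.trans h3)).le
  have h9 : 8 * Cn * d ^ 2 * batchLog L d lam e ^ 3 / (lam ^ 2 * e ^ 6)
      = 2 * (4 * Cn * d ^ 2 * batchLog L d lam e ^ 3 / (lam ^ 2 * e ^ 6)) := by ring
  linarith

/-- `log (n / δ)` is at most a multiple of the logarithm in the batch size. -/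
theorem log_mul_batch_le (hCn : 1 ≤ Cn) {L : ℕ} (hL : 1 ≤ L) (hd : 1 ≤ d) (h0 : 0 < lam)
    (h1 : lam ≤ 1) (he0 : 0 < e) (he : e ≤ 1 / 2) {n : ℝ} (hn0 : 0 < n)
    (hn : n ≤ 8 * Cn * d ^ 2 * batchLog L d lam e ^ 3 / (lam ^ 2 * e ^ 6)) :
    Real.log (10 * L * n) ≤ (Real.log (8 * Cn) + 6) * batchLog L d lam e := by
  have hd0 : (1 : ℝ) ≤ d := by exact_mod_cast hd
  have hL0 : (1 : ℝ) ≤ L := by exact_mod_cast hL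
  obtain ⟨hb1, -, hb3, hb4⟩ := batchLog_bounds hL hd h0 h1 he0 he
  set b := batchLog L d lam e
  have hbpos : 0 < b := by linarith
  -- The 6 is `1 + 2 + 3`: from `log (10 L) ≤ b`, from the squared factor, and from `b ^ 3` with
  -- `log b ≤ b`.
  have h2 : 8 * Cn * d ^ 2 * b ^ 3 / (lam ^ 2 * e ^ 6)
      = (8 * Cn) * ((d / (lam * e ^ 3)) ^ 2 * b ^ 3) := by field_simp
  rw [h2] at hn
  have h3 := Real.log_le_log hn0 hn
  rw [Real.log_mul (x := 8 * Cn) (by positivity) (by positivity),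
    Real.log_mul (x := (d / (lam * e ^ 3)) ^ 2) (by positivity) (by positivity),
    Real.log_pow, Real.log_pow] at h3
  have h4 := Real.log_le_sub_one_of_pos hbpos
  have h5 : 0 ≤ Real.log (8 * Cn) := Real.log_nonneg (by linarith)
  have h6 : Real.log (8 * Cn) * 1 ≤ Real.log (8 * Cn) * b := by gcongr
  rw [Real.log_mul (by positivity) hn0.ne']
  push_cast at h3
  linarith

/-- Cruder bound for the logarithm in the batch size. -/
theorem batchLog_le (hCL : 64 ≤ CL) (hd : 1 ≤ d) (h0 : 0 < lam)
    (he0 : 0 < e) (he : e ≤ 1 / 2) :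
    batchLog (npmIters CL d (1 - e ^ 2 / 2) e) d lam e
      ≤ Real.log (20 * (2 * CL + 1)) + 6 * Real.log (d / e) + Real.log (1 / lam) := by
  have hd0 : (1 : ℝ) ≤ d := by exact_mod_cast hd
  obtain ⟨-, h1⟩ := npmIters_bounds hCL hd he0 he
  have hde : 0 < (d : ℝ) / e := by positivity
  have h2 : Real.log (d / e) ≤ d / e := by
    have := Real.log_le_sub_one_of_pos hde
    linarith
  have hL0 : (0 : ℝ) < npmIters CL d (1 - e ^ 2 / 2) e := by
    unfold npmIters; positivity
  rw [← Nat.cast_ofNat (n := 6), ← Real.log_pow,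
    ← Real.log_mul (by positivity) (by positivity), ← Real.log_mul (by positivity) (by positivity),
    batchLog]
  apply Real.log_le_log (by positivity)
  calc 20 * (npmIters CL d (1 - e ^ 2 / 2) e : ℝ) * d / (lam * e ^ 3)
      ≤ 20 * ((2 * CL + 1) * (d / e) / e ^ 2) * d / (lam * e ^ 3) := by
        gcongr
        refine h1.trans ?_
        gcongr
    _ = 20 * (2 * CL + 1) * (d ^ 2 / e ^ 6) * (1 / lam) := by field_simp
    _ ≤ 20 * (2 * CL + 1) * (d / e) ^ 6 * (1 / lam) := by
        rw [div_pow]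
        gcongr
        norm_num

/-- With `16 ≤ e³` and `√2 ≤ e^(1/2)`, the exponent is at most `3 + d/2 - 28 d/8 = 3 - 3 d ≤ 0`. -/
theorem sqrt_two_pow_mul_exp_le {m : ℝ} (hm : 28 * d ≤ m) (hd : 1 ≤ d) :
    16 * (√2 ^ d * Real.exp (-(m / 8))) ≤ 1 := by
  have hd0 : (1 : ℝ) ≤ d := by exact_mod_cast hd
  have h1 : √2 ≤ Real.exp (1 / 2) := by
    apply Real.sqrt_le_iff.2 ⟨(Real.exp_pos _).le, ?_⟩
    rw [← Real.exp_nat_mul]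
    have := Real.exp_one_gt_d9
    norm_num
    linarith
  have h2 : √2 ^ d ≤ Real.exp (d / 2) := by
    calc √2 ^ d ≤ Real.exp (1 / 2) ^ d := by gcongr
      _ = _ := by rw [← Real.exp_nat_mul]; congr 1; ring
  have h3 : (16 : ℝ) ≤ Real.exp 3 := by
    have h4 : Real.exp 3 = Real.exp 1 ^ 3 := by rw [← Real.exp_nat_mul]; norm_num
    have h5 : (2.7 : ℝ) ^ 3 ≤ Real.exp 1 ^ 3 := by
      gcongr
      have := Real.exp_one_gt_d9
      linarith
    rw [h4]
    norm_num at h5 ⊢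
    linarith
  calc 16 * (√2 ^ d * Real.exp (-(m / 8)))
      ≤ Real.exp 3 * (Real.exp (d / 2) * Real.exp (-(m / 8))) := by gcongr
    _ = Real.exp (3 + (d / 2 + -(m / 8))) := by rw [Real.exp_add, Real.exp_add]
    _ ≤ 1 := by rw [Real.exp_le_one_iff]; linarith

theorem half_le_gaussianVec_ball {m : ℝ} (hm : 28 * d ≤ m) (hd : 1 ≤ d) :
    1 / 2 ≤ (gaussianVec d m).real (Metric.closedBall 0 1) := by
  have hd0 : (1 : ℝ) ≤ d := by exact_mod_cast hd
  have h1 := gaussianVec_compl_ball_le d (m := m) (by linarith)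
  have h2 := sqrt_two_pow_mul_exp_le hm hd
  rw [measureReal_compl measurableSet_closedBall, probReal_univ] at h1
  have h3 : √2 ^ d * Real.exp (-(m / 4)) ≤ √2 ^ d * Real.exp (-(m / 8)) := by
    have h4 : 0 ≤ m := by linarith
    gcongr
    norm_num
  linarith

/-- The right side is at least `16 log (d/e)` because `CL ≥ 64`, the left at most `8 + log (d/e)`,
and `15 · 0.69 > 8`. -/
theorem log_iters_condition (hCL : 64 ≤ CL) (hd : 1 ≤ d) (he0 : 0 < e) (he : e ≤ 1 / 2) :
    1 + Real.log (640 * √d) < npmIters CL d (1 - e ^ 2 / 2) e * (e ^ 2 / 8) := by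
  have hd0 : (1 : ℝ) ≤ d := by exact_mod_cast hd
  obtain ⟨h1, -⟩ := npmIters_bounds hCL hd he0 he
  have hl := half_le_log_div hd he0 he
  have h2 : CL * Real.log (d / e) / 4 ≤ npmIters CL d (1 - e ^ 2 / 2) e * (e ^ 2 / 8) := by
    calc CL * Real.log (d / e) / 4 = 2 * CL * Real.log (d / e) / e ^ 2 * (e ^ 2 / 8) := by
          field_simp; norm_num
      _ ≤ _ := by gcongr
  have h3 : Real.log 640 ≤ 7 := by
    rw [Real.log_le_iff_le_exp (by norm_num)]
    have h4 : Real.exp 7 = Real.exp 1 ^ 7 := by rw [← Real.exp_nat_mul]; norm_num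
    have h5 : (2.7 : ℝ) ^ 7 ≤ Real.exp 1 ^ 7 := by
      gcongr
      have := Real.exp_one_gt_d9
      linarith
    rw [h4]
    norm_num at h5 ⊢
    linarith
  have h6 : Real.log √d ≤ Real.log (d / e) := by
    apply Real.log_le_log (by positivity)
    have h7 : √(d : ℝ) ≤ d := Real.sqrt_le_iff.2 ⟨by linarith, by nlinarith⟩
    rw [le_div_iff₀ he0]
    nlinarith [Real.sqrt_nonneg (d : ℝ)]
  rw [Real.log_mul (by norm_num) (by positivity)]
  nlinarith

/-- The inputs of the method satisfy the conditions for success. -/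
theorem npmParams_conditions (hCL : 64 ≤ CL) (hCm : 14 ≤ Cm) (hCn : 1 ≤ Cn)
    (hC : 6000000000 * (2 * CL + 1) ^ 2 * Cm * (Real.log (8 * Cn) + 6) ≤ 4 * Cn)
    (hd : 1 ≤ d) (h0 : 0 < lam) (h1 : lam ≤ 1) (he0 : 0 < e) (he : e ≤ 1 / 2)
    {P : NPMParams} (hP : P = npmParams CL Cm Cn 3 d lam (1 - e ^ 2 / 2) e) :
    28 * d ≤ P.prec ∧ 0 < P.batch ∧ 0 < P.iters ∧
      1 + Real.log (640 * √d) < P.iters * (e ^ 2 / 8) ∧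
      6000000000 * P.iters ^ 2 * (P.prec * d) ≤ P.batch * (lam ^ 2 * e ^ 2) ∧
      (P.samples : ℝ) ≤ (2 * CL + 1) * Real.log (d / e) / e ^ 2 *
        (8 * Cn * d ^ 2 * batchLog P.iters d lam e ^ 3 / (lam ^ 2 * e ^ 6)) ∧
      P.iters = npmIters CL d (1 - e ^ 2 / 2) e := by
  have hd0 : (1 : ℝ) ≤ d := by exact_mod_cast hd
  have hl := half_le_log_div hd he0 he
  have hI : P.iters = npmIters CL d (1 - e ^ 2 / 2) e := by rw [hP]; rfl
  have hL : 1 ≤ P.iters := by rw [hI]; unfold npmIters; omega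
  have hL0 : (1 : ℝ) ≤ P.iters := by exact_mod_cast hL
  have hB : P.batch = npmBatch Cn 3 d lam (1 - e ^ 2 / 2) e (1 / (10 * P.iters)) := by
    rw [hI, hP]; rfl
  obtain ⟨hL1, hL2⟩ := npmIters_bounds hCL hd he0 he
  rw [← hI] at hL1 hL2
  obtain ⟨hn1, hn2⟩ := npmBatch_bounds hCn hL hd h0 h1 he0 he
  rw [← hB] at hn1 hn2
  obtain ⟨hb1, hb2, -, -⟩ := batchLog_bounds hL hd h0 h1 he0 he
  have hn0 : (0 : ℝ) < P.batch := lt_of_lt_of_le (by positivity) hn1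
  have hn0' : 0 < P.batch := by exact_mod_cast hn0
  have hn1' : (1 : ℝ) ≤ P.batch := by exact_mod_cast hn0'
  have hprec : P.prec = Cm * d * Real.log (10 * P.iters * P.batch) := by
    have h2 : P.prec = Cm * d * Real.log (P.batch / (1 / (10 * P.iters))) := by rw [hP]; rfl
    rw [h2]
    congr 2
    field_simp
  have hlog := log_mul_batch_le hCn hL hd h0 h1 he0 he hn0 hn2
  -- Together with `Cm ≥ 14` this gives the 28 in `28 * d ≤ P.prec`.
  have hlog2 : 2 ≤ Real.log (10 * P.iters * P.batch) := by
    have h2 : (10 : ℝ) ≤ 10 * P.iters * P.batch := by nlinarith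
    have h3 : 2 ≤ Real.log 10 := by
      rw [Real.le_log_iff_exp_le (by norm_num)]
      have h4 : Real.exp 2 = Real.exp 1 ^ 2 := by rw [← Real.exp_nat_mul]; norm_num
      rw [h4]
      nlinarith [Real.exp_one_lt_three, Real.exp_pos 1]
    exact h3.trans (Real.log_le_log (by norm_num) h2)
  refine ⟨?_, hn0', hL, by rw [hI]; exact log_iters_condition hCL hd he0 he, ?_, ?_, hI⟩
  · rw [hprec]
    calc (28 : ℝ) * d = 14 * d * 2 := by ring
      _ ≤ _ := by gcongr
  · set b := batchLog P.iters d lam e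
    rw [hprec]
    -- `L²` brings two logarithms and `m` one: this is the exponent `q = 3`.
    calc 6000000000 * (P.iters : ℝ) ^ 2
          * (Cm * d * Real.log (10 * P.iters * P.batch) * d)
        ≤ 6000000000 * ((2 * CL + 1) * b / e ^ 2) ^ 2
          * (Cm * d * ((Real.log (8 * Cn) + 6) * b) * d) := by
          gcongr
          · refine hL2.trans ?_
            gcongr
      _ = (6000000000 * (2 * CL + 1) ^ 2 * Cm * (Real.log (8 * Cn) + 6))
          * (b ^ 3 * d ^ 2 / e ^ 4) := by ring
      _ ≤ 4 * Cn * (b ^ 3 * d ^ 2 / e ^ 4) := by gcongr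
      _ = 4 * Cn * d ^ 2 * b ^ 3 / (lam ^ 2 * e ^ 6) * (lam ^ 2 * e ^ 2) := by
          field_simp
      _ ≤ _ := by gcongr
  · unfold NPMParams.samples
    push_cast
    gcongr

/-- The precision `m` grows with `log n`, hence with `log Cn`, so `Cn` has to dominate a multiple of
its own logarithm. -/
theorem exists_forall_log_le (K : ℝ) (hK : 0 < K) :
    ∃ Cn₀ > (0 : ℝ), ∀ Cn ≥ Cn₀, 1 ≤ Cn ∧ K * (Real.log (8 * Cn) + 6) ≤ 4 * Cn := by
  have h1 : ∀ᶠ x : ℝ in Filter.atTop, Real.log x ≤ 1 / (4 * K) * x := by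
    have h2 := Real.isLittleO_log_id_atTop.bound (show (0 : ℝ) < 1 / (4 * K) by positivity)
    filter_upwards [h2, Filter.eventually_ge_atTop 1] with x hx hx1
    simp only [id, Real.norm_eq_abs, abs_of_nonneg (zero_le_one.trans hx1)] at hx
    exact (le_abs_self _).trans hx
  have h3 : Filter.Tendsto (fun x : ℝ => 8 * x) Filter.atTop Filter.atTop :=
    Filter.tendsto_id.const_mul_atTop (by norm_num)
  have h4 := (h3.eventually h1).and (Filter.eventually_ge_atTop (max 1 (3 * K)))
  obtain ⟨c, hc⟩ := Filter.eventually_atTop.1 h4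
  refine ⟨max c 1, by positivity, fun Cn hCn => ?_⟩
  obtain ⟨h5, h6⟩ := hc Cn ((le_max_left _ _).trans hCn)
  refine ⟨(le_max_left _ _).trans h6, ?_⟩
  have h7 : 3 * K ≤ Cn := (le_max_right _ _).trans h6
  have h8 := mul_le_mul_of_nonneg_left h5 hK.le
  have h9 : K * (1 / (4 * K) * (8 * Cn)) = 2 * Cn := by field_simp; ring
  linarith

end Parameters

/-! ### Sample count, regret and conclusion. -/

section Regret

variable {CL Cm Cn e lam : ℝ} {d : ℕ}

/-- Number of samples in terms of a common bound `τ` for the logarithms. -/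
theorem samples_le (hCL : 64 ≤ CL) (hCm : 14 ≤ Cm) (hCn : 1 ≤ Cn)
    (hC : 6000000000 * (2 * CL + 1) ^ 2 * Cm * (Real.log (8 * Cn) + 6) ≤ 4 * Cn)
    (hd : 1 ≤ d) (h0 : 0 < lam) (h1 : lam ≤ 1) (he0 : 0 < e) (he : e ≤ 1 / 2)
    {P : NPMParams} (hP : P = npmParams CL Cm Cn 3 d lam (1 - e ^ 2 / 2) e)
    {τ : ℝ} (hτ : 1 ≤ τ) (hτ1 : Real.log (d / e) ≤ τ) (hτ2 : Real.log (1 / lam) ≤ τ) :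
    (P.samples : ℝ) ≤ (2 * CL + 1) * (8 * Cn) * (Real.log (20 * (2 * CL + 1)) + 7) ^ 3
      * (d ^ 2 / (lam ^ 2 * e ^ 8)) * τ ^ 4 := by
  have hd0 : (1 : ℝ) ≤ d := by exact_mod_cast hd
  obtain ⟨-, -, hL, -, -, hS, hI⟩ := npmParams_conditions hCL hCm hCn hC hd h0 h1 he0 he hP
  have hb := batchLog_le hCL hd h0 he0 he
  rw [← hI] at hb
  obtain ⟨hb1, -⟩ := batchLog_bounds hL hd h0 h1 he0 he
  have hK : 0 ≤ Real.log (20 * (2 * CL + 1)) := Real.log_nonneg (by linarith)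
  have hb2 : batchLog P.iters d lam e ≤ (Real.log (20 * (2 * CL + 1)) + 7) * τ := by
    nlinarith
  calc (P.samples : ℝ) ≤ (2 * CL + 1) * Real.log (d / e) / e ^ 2 *
        (8 * Cn * d ^ 2 * batchLog P.iters d lam e ^ 3 / (lam ^ 2 * e ^ 6)) := hS
    -- One factor `τ` from `L` and three from `n`: this is the exponent `p = 4`.
    _ ≤ (2 * CL + 1) * τ / e ^ 2 * (8 * Cn * d ^ 2
          * ((Real.log (20 * (2 * CL + 1)) + 7) * τ) ^ 3 / (lam ^ 2 * e ^ 6)) := by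
        gcongr
    _ = _ := by field_simp

theorem IsNPMRun.prob_npmParams (hCL : 64 ≤ CL) (hCm : 14 ≤ Cm) (hCn : 1 ≤ Cn)
    (hC : 6000000000 * (2 * CL + 1) ^ 2 * Cm * (Real.log (8 * Cn) + 6) ≤ 4 * Cn)
    (hd : 1 ≤ d) {M : Matrix (Fin d) (Fin d) ℝ} (hM : M.PosSemidef)
    (hlam : IsGreatest (spectrum ℝ M) lam) (h0 : 0 < lam) (h1 : lam ≤ 1) (he0 : 0 < e)
    (he : e ≤ 1 / 2)
    {P : NPMParams} (hP : P = npmParams CL Cm Cn 3 d lam (1 - e ^ 2 / 2) e)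
    {Ω : Type*} [MeasurableSpace Ω] {μ : Measure Ω} [IsProbabilityMeasure μ]
    {A₀ : Ω → Vec d} {Z : ℕ → Ω → Fin P.batch → Vec d} {η : ℕ → Ω → ℝ}
    (h : IsNPMRun μ P A₀ Z η) :
    9 / 10 ≤ μ.real {ω | bestReward M
      - quadReward M (npmOutput M P (A₀ ω) (fun l => Z l ω) (fun t => η t ω)) ≤ lam * e ^ 2} := by
  have hd0 : (1 : ℝ) ≤ d := by exact_mod_cast hd
  obtain ⟨hm, hB, hL, hLe, hn, -, -⟩ := npmParams_conditions hCL hCm hCn hC hd h0 h1 he0 he hP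
  exact h.prob_success hM hlam h0 h1 hd he0 he (by linarith) hB
    (half_le_gaussianVec_ball hm hd) (sqrt_two_pow_mul_exp_le hm hd) hL hLe hn

/-- Regret of any sequence of actions. -/
theorem cumRegret_le {M : Matrix (Fin d) (Fin d) ℝ} (hM : M.PosSemidef)
    (hlam : IsGreatest (spectrum ℝ M) lam) (h0 : 0 ≤ lam) (a : ℕ → Vec d) (T : ℕ) :
    cumRegret M a T ≤ lam * T := by
  unfold cumRegret
  calc _ ≤ ∑ _t ∈ Finset.range T, lam := by
        refine Finset.sum_le_sum fun t _ => ?_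
        linarith [bestReward_le hM hlam h0, quadReward_nonneg hM (a t)]
    _ = _ := by simp [mul_comm]

/-- Regret of explore-then-commit when the committed action is `b`-optimal. -/
theorem cumRegret_etcAction_le {M : Matrix (Fin d) (Fin d) ℝ} (hM : M.PosSemidef)
    (hlam : IsGreatest (spectrum ℝ M) lam) (h0 : 0 ≤ lam) {P : NPMParams} {a₀ : Vec d}
    {z : ℕ → Fin P.batch → Vec d} {η : ℕ → ℝ} {b : ℝ} (hb0 : 0 ≤ b)
    (hb : bestReward M - quadReward M (npmOutput M P a₀ z η) ≤ b) (T : ℕ) :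
    cumRegret M (etcAction M P a₀ z η) T ≤ lam * P.samples + T * b := by
  unfold cumRegret
  have hterm : ∀ t, bestReward M - quadReward M (etcAction M P a₀ z η t)
      ≤ (if t < P.samples then lam else 0) + b := by
    intro t
    by_cases ht : t < P.samples
    · rw [if_pos ht]
      linarith [bestReward_le hM hlam h0, quadReward_nonneg hM (etcAction M P a₀ z η t)]
    · rw [if_neg ht, zero_add, etcAction, dif_neg ht]
      exact hb
  refine (Finset.sum_le_sum fun t _ => hterm t).trans ?_
  rw [Finset.sum_add_distrib, ← Finset.sum_filter]
  simp only [Finset.sum_const, Finset.card_range, nsmul_eq_mul]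
  have hcard : ((Finset.range T).filter (· < P.samples)).card ≤ P.samples := by
    calc _ ≤ (Finset.range P.samples).card := Finset.card_le_card fun t ht => by
          simpa using (Finset.mem_filter.1 ht).2
      _ = _ := Finset.card_range _
  have : ((((Finset.range T).filter (· < P.samples)).card : ℕ) : ℝ) ≤ P.samples := by
    exact_mod_cast hcard
  nlinarith

/-- The tenth root is the value of `e` at which `lam · D²/(lam² e⁸)` and `lam T e²` agree. After
taking logarithms the identity is linear. -/
theorem regret_rate_eq {D T : ℝ} (h0 : 0 < lam) (hd : 0 < D) (hT : 0 < T) :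
    lam * T * ((D ^ 2 / (lam ^ 2 * T)) ^ (1 / 10 : ℝ)) ^ 2
      = lam ^ (3 / 5 : ℝ) * D ^ (2 / 5 : ℝ) * T ^ (4 / 5 : ℝ) := by
  have hx : 0 < D ^ 2 / (lam ^ 2 * T) := by positivity
  rw [← Real.log_injOn_pos.eq_iff (Set.mem_Ioi.2 (by positivity)) (Set.mem_Ioi.2 (by positivity)),
    Real.log_mul (by positivity) (by positivity), Real.log_mul (by positivity) (by positivity),
    Real.log_mul (by positivity) (by positivity), Real.log_mul (by positivity) (by positivity),
    Real.log_pow, Real.log_rpow hx, Real.log_rpow h0, Real.log_rpow hd, Real.log_rpow hT,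
    Real.log_div (by positivity) (by positivity), Real.log_mul (by positivity) (by positivity),
    Real.log_pow, Real.log_pow]
  push_cast
  ring

end Regret

theorem mainTheorem11 :
    ∃ q p : ℕ, ∃ CL₀ > (0 : ℝ), ∀ CL ≥ CL₀, ∃ Cm₀ > (0 : ℝ), ∀ Cm ≥ Cm₀,
      ∃ Cn₀ > (0 : ℝ), ∀ Cn ≥ Cn₀, ∃ C > (0 : ℝ),
      ∀ (d : ℕ), 1 ≤ d → ∀ (M : Matrix (Fin d) (Fin d) ℝ), M.PosSemidef →
      ∀ (lam : ℝ), IsGreatest (spectrum ℝ M) lam → 0 < lam → lam ≤ 1 →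
      -- sample complexity of finding an `ε`-optimal action
      (∀ (ε : ℝ), 0 < ε → ε < lam / 4 →
        ∀ (e : ℝ), e = Real.sqrt (ε / lam) →
        ∀ (P : NPMParams), P = npmParams CL Cm Cn q d lam (1 - e ^ 2 / 2) e →
          (P.samples : ℝ) ≤ C * ((d : ℝ) ^ 2 * lam ^ 2 / ε ^ 4) * Real.log (d / ε) ^ p ∧
          ∀ {Ω : Type*} [MeasurableSpace Ω] (μ : Measure Ω) [IsProbabilityMeasure μ]
            (A₀ : Ω → Vec d) (Z : ℕ → Ω → Fin P.batch → Vec d) (η : ℕ → Ω → ℝ),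
            IsNPMRun μ P A₀ Z η →
            9 / 10 ≤ μ.real {ω | bestReward M
              - quadReward M (npmOutput M P (A₀ ω) (fun l => Z l ω) (fun t => η t ω)) ≤ ε}) ∧
      -- regret of explore-then-commit
      (∀ (T : ℕ), 1 ≤ T →
        ∀ (e : ℝ), e = min (1 / 4) (((d : ℝ) ^ 2 / (lam ^ 2 * T)) ^ (1 / 10 : ℝ)) →
        ∀ (P : NPMParams), P = npmParams CL Cm Cn q d lam (1 - e ^ 2 / 2) e →
          ∀ {Ω : Type*} [MeasurableSpace Ω] (μ : Measure Ω) [IsProbabilityMeasure μ]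
            (A₀ : Ω → Vec d) (Z : ℕ → Ω → Fin P.batch → Vec d) (η : ℕ → Ω → ℝ),
            IsNPMRun μ P A₀ Z η →
            (∀ᵐ ω ∂μ, ∀ t,
              ‖etcAction M P (A₀ ω) (fun l => Z l ω) (fun s => η s ω) t‖ ≤ 1) ∧
            9 / 10 ≤ μ.real {ω |
              cumRegret M (etcAction M P (A₀ ω) (fun l => Z l ω) (fun s => η s ω)) T
                ≤ C * (lam ^ (3 / 5 : ℝ) * (d : ℝ) ^ (2 / 5 : ℝ) * (T : ℝ) ^ (4 / 5 : ℝ))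
                  * (1 + Real.log (d * T)) ^ p}) := by
  refine ⟨3, 4, 64, by norm_num, fun CL hCL => ⟨14, by norm_num, fun Cm hCm => ?_⟩⟩
  have hCL0 : 0 < CL := by linarith
  have hCm0 : 0 < Cm := by linarith
  obtain ⟨Cn₀, hCn₀, hCn⟩ := exists_forall_log_le (6000000000 * (2 * CL + 1) ^ 2 * Cm)
    (by positivity)
  refine ⟨Cn₀, hCn₀, fun Cn hCn' => ?_⟩
  obtain ⟨hCn1, hC⟩ := hCn Cn hCn'
  have hK : 0 ≤ Real.log (20 * (2 * CL + 1)) := Real.log_nonneg (by linarith)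
  set B : ℝ := (2 * CL + 1) * (8 * Cn) * (Real.log (20 * (2 * CL + 1)) + 7) ^ 3 with hB
  have hB0 : 0 ≤ B := by positivity
  -- `B` pays for exploration; 16 pays for the committed rounds and for the case of a clipped `e`.
  refine ⟨B + 16, by positivity, fun d hd M hM lam hlam h0 h1 => ⟨?_, ?_⟩⟩
  · intro ε hε0 hε e he P hP
    have hd0 : (1 : ℝ) ≤ d := by exact_mod_cast hd
    have he2 : e ^ 2 = ε / lam := by rw [he, Real.sq_sqrt (by positivity)]
    have he0 : 0 < e := by rw [he]; positivity
    have he1 : e ≤ 1 / 2 := by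
      refine (abs_le_of_sq_le_sq' ?_ (by norm_num)).2
      rw [he2, div_le_iff₀ h0]
      linarith
    refine ⟨?_, fun μ _ A₀ Z η h => ?_⟩
    · have hτ : 1 ≤ Real.log (d / ε) := by
        rw [Real.le_log_iff_exp_le (by positivity), le_div_iff₀ hε0]
        nlinarith [Real.exp_one_lt_three, Real.exp_pos 1]
      -- As `lam ≤ 1`, `ε ≤ ε / lam = e² ≤ e`; so `log (d/ε)` dominates both logarithms in
      -- `samples_le`.
      have hεe : ε ≤ e := by
        have : ε ≤ e ^ 2 := by
          rw [he2, le_div_iff₀ h0]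
          nlinarith
        nlinarith
      have h2 := samples_le hCL hCm hCn1 hC hd h0 h1 he0 he1 hP hτ
        (Real.log_le_log (by positivity) (by gcongr))
        (Real.log_le_log (by positivity) (by gcongr; linarith))
      refine h2.trans ?_
      have h3 : (d : ℝ) ^ 2 / (lam ^ 2 * e ^ 8) = d ^ 2 * lam ^ 2 / ε ^ 4 := by
        rw [show e ^ 8 = (e ^ 2) ^ 4 by ring, he2]
        field_simp
      rw [h3]
      gcongr
      linarith
    · have h2 := h.prob_npmParams hCL hCm hCn1 hC hd hM hlam h0 h1 he0 he1 hP
      rwa [he2, mul_div_cancel₀ _ h0.ne'] at h2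
  · intro T hT e he P hP Ω _ μ _ A₀ Z η h
    refine ⟨h.ae_norm_etcAction_le, ?_⟩
    have hd0 : (1 : ℝ) ≤ d := by exact_mod_cast hd
    have hT0 : (1 : ℝ) ≤ T := by exact_mod_cast hT
    have hlog : 0 ≤ Real.log (d * T) := Real.log_nonneg (one_le_mul_of_one_le_of_one_le hd0 hT0)
    have hτ : 1 ≤ 1 + Real.log (d * T) := by linarith
    have hτ4 : 1 ≤ (1 + Real.log (d * T)) ^ 4 := one_le_pow₀ hτ
    rw [← regret_rate_eq h0 (by linarith) (by linarith)]
    set x : ℝ := ((d : ℝ) ^ 2 / (lam ^ 2 * T)) ^ (1 / 10 : ℝ) with hx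
    have hx0 : 0 < x := by positivity
    rcases le_total (1 / 4) x with hx4 | hx4
    -- If `e` is clipped at `1/4`, then `lam T ≤ 16 lam T x²`, and the trivial regret bound is
    -- enough.
    · have hall : ∀ ω, cumRegret M (etcAction M P (A₀ ω) (fun l => Z l ω) (fun s => η s ω)) T
          ≤ (B + 16) * (lam * T * x ^ 2) * (1 + Real.log (d * T)) ^ 4 := fun ω => by
        refine (cumRegret_le hM hlam h0.le _ T).trans ?_
        have h2 : 1 / 16 ≤ x ^ 2 := by nlinarith
        calc lam * T = 16 * (lam * T * (1 / 16)) * 1 := by ring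
          _ ≤ _ := by
            gcongr
            linarith
      rw [show {ω | cumRegret M (etcAction M P (A₀ ω) (fun l => Z l ω) (fun s => η s ω)) T
          ≤ (B + 16) * (lam * T * x ^ 2) * (1 + Real.log (d * T)) ^ 4} = Set.univ from
        Set.eq_univ_of_forall hall, probReal_univ]
      norm_num
    · rw [min_eq_right hx4] at he
      have he0 : 0 < e := he ▸ hx0
      have he1 : e ≤ 1 / 4 := he ▸ hx4
      have he10 : e ^ 10 = (d : ℝ) ^ 2 / (lam ^ 2 * T) := by
        rw [he, hx, ← Real.rpow_natCast, ← Real.rpow_mul (by positivity)]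
        norm_num
      have hmul : e ^ 10 * (lam ^ 2 * T) = d ^ 2 := by
        rw [he10]; field_simp
      -- From `1 ≤ d² = e¹⁰ lam² T ≤ e T`; this and the next bound reduce the logarithms to `log (d
      -- T)`.
      have heT : 1 / e ≤ T := by
        rw [div_le_iff₀ he0]
        have h2 : e ^ 10 ≤ e := pow_le_of_le_one he0.le (by linarith) (by norm_num)
        have h3 : lam ^ 2 ≤ 1 := pow_le_one₀ h0.le h1
        have h4 : e ^ 10 * (lam ^ 2 * T) ≤ e * (1 * T) := by gcongr
        nlinarith
      have hlamT : 1 / lam ≤ d * T := by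
        rw [div_le_iff₀ h0]
        have h2 : e ^ 10 ≤ 1 := pow_le_one₀ he0.le (by linarith)
        have h3 : e ^ 10 * (lam ^ 2 * T) ≤ 1 * (lam * T) := by
          gcongr
          nlinarith
        nlinarith
      have hprob := h.prob_npmParams hCL hCm hCn1 hC hd hM hlam h0 h1 he0 (by linarith) hP
      have hS := samples_le hCL hCm hCn1 hC hd h0 h1 he0 (by linarith) hP hτ
        (by
          have h2 : Real.log (d / e) ≤ Real.log (d * T) := by
            apply Real.log_le_log (by positivity)
            rw [div_eq_mul_one_div]
            gcongr
          linarith)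
        (by
          have h2 := Real.log_le_log (by positivity) hlamT
          linarith)
      refine hprob.trans (measureReal_mono (fun ω hω => ?_) (measure_ne_top _ _))
      have h2 := cumRegret_etcAction_le hM hlam h0.le (by positivity) hω T
      refine h2.trans ?_
      have h3 : lam * ((d : ℝ) ^ 2 / (lam ^ 2 * e ^ 8)) = lam * T * e ^ 2 := by
        rw [← hmul]; field_simp
      have h4 := mul_le_mul_of_nonneg_left hS h0.le
      rw [← he]
      set τ := (1 + Real.log (d * T)) ^ 4
      have h5 : lam * (B * ((d : ℝ) ^ 2 / (lam ^ 2 * e ^ 8)) * τ) = B * (lam * T * e ^ 2) * τ := by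
        rw [← h3]; ring
      have h6 : (T : ℝ) * (lam * e ^ 2) ≤ 16 * (lam * T * e ^ 2) * τ := by
        calc (T : ℝ) * (lam * e ^ 2) = 1 * (lam * T * e ^ 2) * 1 := by ring
          _ ≤ _ := by gcongr; norm_num
      rw [← hB, h5] at h4
      linarith
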